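/- **Setting.** Let $n\ge 1$ and let $M$ be a complete (connected) $n$-dimensional smooth orientable Riemannian manifold, with Riemannian distance $d$, that is locally Euclidean: every point has a neighbourhood isometric to an open subset of $\mathbb R^n$. Let $G=(V,E)$ be a finite directed multigraph, $V\neq\emptyset$. To every edge $e\in E$ let there correspond a contractive similitude $S_e:M\to M$ with ratio $\rho_e\in(0,1)$, i.e. $d(S_e(x),S_e(y))=\rho_e\,d(x,y)$ for all $x,y\in M$. Let $E^{i,j}$ be the set of edges from $i$ to $j$ and $E^*$ the set of directed paths of length $\ge 1$. For $\mathbf e=e_1\cdots e_p$ put $|\mathbf e|=p$, $S_{\mathbf e}=S_{e_1}\circ\cdots\circ S_{e_p}$ and $\rho_{\mathbf e}=\rho_{e_1}\cdots\rho_{e_p}$; for an empty path these are $0$, $\mathrm{id}$ and $1$. Write $\mathbf u\preceq\mathbf v$ if $\mathbf u$ is an initial segment of, or equal to, $\mathbf v$. Let $(K_i)_{i\in V}$ be nonempty compact sets with $K_i=\bigcup_{j\in V}\bigcup_{e\in E^{i,j}}S_e(K_j)$ (so every vertex has an outgoing edge), and let $K=\bigcup_{i\in V}K_i$ be the graph self-similar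 set. **Nested index sets.** Nonempty finite sets $\mathcal F_k\subset E^*$ ($k\ge1$) form a sequence of nested index sets if, with $\underline m_k$ and $\overline m_k$ the minimal and maximal length of a path in $\mathcal F_k$: (a) $\underline m_k$ and $\overline m_k$ are nondecreasing in $k$ and tend to $\infty$; (b) no two distinct elements of $\mathcal F_k$ are comparable for $\preceq$; (c) every $\mathbf v\in E^*$ with $|\mathbf v|>\overline m_k$ or $\mathbf v\in\mathcal F_{k+1}$ has some $\mathbf u\in\mathcal F_k$ with $\mathbf u\preceq\mathbf v$; (d) every $\mathbf v\in E^*$ with $|\mathbf v|<\underline m_k$ has some $\mathbf u\in\mathcal F_k$ with $\mathbf v\preceq\mathbf u$, and every $\mathbf v\in\mathcal F_k$ has some $\mathbf u\in\mathcal F_{k+1}$ with $\mathbf v\preceq\mathbf u$; (e) there is $L$ such that $|\mathbf v|-|\mathbf u|\le L$ whenever $k\ge1$, $\mathbf u\in\mathcal F_k$, $\mathbf v\in\mathcal F_{k+1}$ and $\mathbf u\preceq\mathbf v$. Let $\mathcal F_0$ consist of the empty paths at the vertices of $G$. **Levels.** Let $\mathbb V_k$ be the set of all $(S_{\mathbf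 e},i,j,k)$ with $\mathbf e\in\mathcal F_k$ a path from $i$ to $j$; we say that $\mathbf e$ represents this vertex. Let $\mathbb V=\bigcup_{k\ge0}\mathbb V_k$, and for $\omega=(S,i,j,k)\in\mathbb V$ write $S_\omega=S$, $i_\omega=i$, $j_\omega=j$. There is a directed edge with label $\mathbf k$ from $\omega\in\mathbb V_k$ to $\sigma\in\mathbb V_{k+1}$ if $i_\omega=i_\sigma$ and there are a representative $\mathbf e$ of $\omega$ and a representative $\mathbf e'$ of $\sigma$ with $\mathbf e'=\mathbf e\mathbf k$, where $\mathbf k$ is a directed path, possibly empty. Fix a linear order on $E$. Among all edges going to a given vertex keep only the one whose label is lexicographically smallest; then remove successively all vertices without offspring, together with the vertices and edges leading only to removed vertices. What remains is the reduced graph $\mathbb G_R=(\mathbb V_R,\mathbb E_R)$. **Graph finite type condition.** Let $\mathbf\Omega=(\Omega_i)_{i\in V}$ be nonempty bounded open subsets of $M$ with $S_e(\Omega_j)\subset\Omega_i$ for all $e\in E^{i,j}$. The neighbourhood $\mathcal N(\omega)$ of $\omega\in\mathbb V_k$ is the set of all $\sigma\in\mathbb V_k$ with $i_\sigma=i_\omega$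 and $S_\omega(\Omega_{j_\omega})\cap S_\sigma(\Omega_{j_\sigma})\ne\emptyset$. Vertices $\omega\in\mathbb V_k$ and $\omega'\in\mathbb V_{k'}$ are equivalent if $j_\omega=j_{\omega'}$, the bijection $\tau=S_{\omega'}S_\omega^{-1}$ of $M$ induces a bijection $$f_\tau:\mathcal N(\omega)\to\mathcal N(\omega'),\qquad f_\tau(S_\sigma,i_\omega,j_\sigma,k)=(\tau\circ S_\sigma,i_{\omega'},j_\sigma,k'),$$ and for all $\sigma\in\mathcal N(\omega)$, with $\sigma'=f_\tau(\sigma)$, all $k_0\ge1$ and all $\mathbf e\in E^*$ from $j_\sigma$ to any $j$: $(S_\sigma\circ S_{\mathbf e},i_\omega,j,k+k_0)\in\mathbb V_{k+k_0}$ if and only if $(S_{\sigma'}\circ S_{\mathbf e},i_{\omega'},j,k'+k_0)\in\mathbb V_{k'+k_0}$. The equivalence classes are the neighbourhood types. $G$ satisfies the graph finite type condition (GFTC) if $\mathbf\Omega$ and nested index sets $(\mathcal F_k)$ can be chosen such that $\mathbb V$ has only finitely many neighbourhood types. **Weighted incidence matrix.** Assume that $G$ satisfies (GFTC), with $\mathbf\Omega$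 and $(\mathcal F_k)$, and let $\mathcal T_1,\dots,\mathcal T_q$ be the neighbourhood types of the vertices in $\mathbb V_R$. For $\beta\in\mathbb R$ the weighted incidence matrix $A_\beta=(A_\beta(i,j))_{i,j=1}^q$ is defined by $$A_\beta(i,j)=\sum\rho_{\mathbf k}^{\,\beta},$$ where $\omega\in\mathbb V_R$ is any vertex of type $\mathcal T_i$ and the sum is over all edges of $\mathbb G_R$ from $\omega$ to vertices of type $\mathcal T_j$, $\mathbf k$ denoting the label of the edge; as is presupposed in this definition, the sum does not depend on the choice of $\omega$. Let $\lambda_\beta$ be the spectral radius of $A_\beta$. **Theorem.** There is exactly one real number $\alpha$ with $\lambda_\alpha=1$; moreover $\alpha\ge0$ and $\dim_{\mathrm H}(K)=\alpha$. -/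

import Mathlib

open scoped Manifold ContDiff Bundle

noncomputable section

/-! ### Manifolds -/

/-- A smooth `n`-manifold is orientable if it is covered by charts of its smooth structure all of
whose coordinate changes have positive Jacobian determinant. -/
def IsOrientableManifold (n : ℕ) (M : Type*) [TopologicalSpace M]
    [ChartedSpace (EuclideanSpace ℝ (Fin n)) M] : Prop :=
  ∃ 𝒜 : Set (OpenPartialHomeomorph M (EuclideanSpace ℝ (Fin n))),
    𝒜 ⊆ IsManifold.maximalAtlas (𝓡 n) ∞ M ∧
    (∀ x : M, ∃ φ ∈ 𝒜, x ∈ φ.source) ∧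
    ∀ φ ∈ 𝒜, ∀ ψ ∈ 𝒜, ∀ y ∈ (φ.symm.trans ψ).source,
      0 < (fderiv ℝ (φ.symm.trans ψ) y).det

/-- Every point has an open neighbourhood `U` which is isometric, for the (Riemannian) distance, to
an open subset of `n`-dimensional Euclidean space. -/
def IsLocallyEuclidean (n : ℕ) (M : Type*) [MetricSpace M] : Prop :=
  ∀ x : M, ∃ U : Set M, IsOpen U ∧ x ∈ U ∧
    ∃ φ : U → EuclideanSpace ℝ (Fin n), Isometry φ ∧ IsOpen (Set.range φ)

/-! ### Graph-directed iterated function systems -/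

/-- A directed (multi)graph with vertex set `V` and edge set `E`, together with a contractive
similitude `map e` of `M` with ratio `ratio e ∈ (0,1)` for every edge `e`. -/
structure SimilitudeGIFS (V E M : Type*) [MetricSpace M] where
  /-- initial vertex of an edge -/
  src : E → V
  /-- terminal vertex of an edge -/
  tgt : E → V
  /-- the similitude attached to an edge -/
  map : E → M → M
  /-- the contraction ratio attached to an edge -/
  ratio : E → ℝ
  ratio_pos : ∀ e, 0 < ratio e
  ratio_lt_one : ∀ e, ratio e < 1
  dist_map : ∀ e x y, dist (map e x) (map e y) = ratio e * dist x y

/-- The tuples `(S, i, j, k)`: a self-map `S` of `M`, an initial vertex `i`, a terminal vertex `j`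
and a level `k`. -/
@[ext]
structure LevelVertex (V M : Type*) where
  map : M → M
  init : V
  term : V
  level : ℕ

namespace SimilitudeGIFS

variable {V E M : Type*} [MetricSpace M] (G : SimilitudeGIFS V E M)

/-- `G.IsPath i p j`: the string of edges `p` is a directed path from `i` to `j`
(the empty string is the path of length `0` from `i` to `i`). -/
def IsPath : V → List E → V → Prop
  | i, [], j => i = j
  | i, e :: p, j => G.src e = i ∧ IsPath (G.tgt e) p j

/-- `S_{e₁ ⋯ e_p} = S_{e₁} ∘ ⋯ ∘ S_{e_p}`. -/
def pathMap : List E → M → M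
  | [] => id
  | e :: p => G.map e ∘ pathMap p

/-- `ρ_{e₁ ⋯ e_p} = ρ_{e₁} ⋯ ρ_{e_p}`. -/
def pathRatio (p : List E) : ℝ := (p.map G.ratio).prod

/-- The family of nonempty compact sets with `K i = ⋃ⱼ ⋃_{e : i → j} S_e (K j)`. The graph
self-similar set is the union of the `K i`. -/
def IsAttractor (K : V → Set M) : Prop :=
  (∀ i, (K i).Nonempty) ∧ (∀ i, IsCompact (K i)) ∧
    ∀ i, K i = ⋃ (e : E) (_ : G.src e = i), G.map e '' K (G.tgt e)

/-- A family of nonempty bounded open sets which is invariant under the system. -/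
def IsInvariantFamily (Ω : V → Set M) : Prop :=
  (∀ i, (Ω i).Nonempty ∧ Bornology.IsBounded (Ω i) ∧ IsOpen (Ω i)) ∧
    ∀ e : E, G.map e '' Ω (G.tgt e) ⊆ Ω (G.src e)

/-! ### Nested index sets -/

/-- The set of directed paths of positive length. -/
def paths : Set (List E) := {p | p ≠ [] ∧ ∃ i j, G.IsPath i p j}

/-- Smallest length of a path in a finite set of paths. -/
def minLength (A : Finset (List E)) : ℕ := sInf {m | ∃ p ∈ A, p.length = m}

/-- Largest length of a path in a finite set of paths. -/
def maxLength (A : Finset (List E)) : ℕ := A.sup List.length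

/-- `(F k)_{k ≥ 1}` is a sequence of nested index sets of directed paths (`F 0` is not used;
`u <+: v` means that `u` is an initial segment of `v`). -/
structure IsNested (F : ℕ → Finset (List E)) : Prop where
  nonempty : ∀ k ≥ 1, (F k).Nonempty
  subset_paths : ∀ k ≥ 1, (F k : Set (List E)) ⊆ G.paths
  minLength_le : ∀ k ≥ 1, minLength (F k) ≤ minLength (F (k + 1))
  maxLength_le : ∀ k ≥ 1, maxLength (F k) ≤ maxLength (F (k + 1))
  tendsto_minLength : Filter.Tendsto (fun k => minLength (F k)) Filter.atTop Filter.atTop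
  tendsto_maxLength : Filter.Tendsto (fun k => maxLength (F k)) Filter.atTop Filter.atTop
  antichain : ∀ k ≥ 1, IsAntichain (fun u v : List E => u <+: v) (F k : Set (List E))
  exists_prefix : ∀ k ≥ 1, ∀ v ∈ G.paths, (maxLength (F k) < v.length ∨ v ∈ F (k + 1)) →
    ∃ u ∈ F k, u <+: v
  exists_extension : ∀ k ≥ 1, ∀ v ∈ G.paths, v.length < minLength (F k) →
    ∃ u ∈ F k, v <+: u
  exists_extension_succ : ∀ k ≥ 1, ∀ v ∈ F k, ∃ u ∈ F (k + 1), v <+: u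
  bounded_step : ∃ L : ℕ, ∀ k ≥ 1, ∀ u ∈ F k, ∀ v ∈ F (k + 1), u <+: v →
    v.length ≤ u.length + L

/-! ### The graph of vertices of all levels -/

/-- The path `p` represents `ν = (S, i, j, k)`: `S = S_p`, `p` leads from `i` to `j`, and `p`
belongs to the `k`-th index set, the `0`-th index set consisting of the paths of length `0` at the
vertices of the graph. -/
def Represents (F : ℕ → Finset (List E)) (p : List E) (ν : LevelVertex V M) : Prop :=
  G.IsPath ν.init p ν.term ∧ G.pathMap p = ν.map ∧
    ((ν.level = 0 ∧ p = []) ∨ (1 ≤ ν.level ∧ p ∈ F ν.level))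

/-- The set of vertices of all levels; those of level `0` are the root vertices `(id, i, i, 0)`. -/
def vertices (F : ℕ → Finset (List E)) : Set (LevelVertex V M) :=
  {ν | ∃ p, G.Represents F p ν}

/-- The directed edge `ν → σ` with label `w`: a representative of `ν` followed by `w` is a
representative of `σ`, which is a vertex of the next level. The label is the empty path if the
two vertices have a common representative. -/
def Edge (F : ℕ → Finset (List E)) (ν : LevelVertex V M) (w : List E)
    (σ : LevelVertex V M) : Prop :=
  σ.level = ν.level + 1 ∧ σ.init = ν.init ∧
    ∃ p, G.Represents F p ν ∧ G.Represents F (p ++ w) σ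

/-- Among the edges going to a vertex, only the one with the lexicographically smallest label is
kept. -/
def MinEdge [LinearOrder E] (F : ℕ → Finset (List E)) (ν : LevelVertex V M) (w : List E)
    (σ : LevelVertex V M) : Prop :=
  G.Edge F ν w σ ∧ ∀ ν' w', G.Edge F ν' w' σ → w ≤ w'

/-- The vertices of the reduced graph. Successively removing the vertices without offspring, and
those leading only to removed ones, leaves the vertices from which an infinite path starts. -/
def reducedVertices [LinearOrder E] (F : ℕ → Finset (List E)) : Set (LevelVertex V M) :=
  {ν | ν ∈ G.vertices F ∧ ∃ s : ℕ → LevelVertex V M, s 0 = ν ∧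
    ∀ m, ∃ w, G.MinEdge F (s m) w (s (m + 1))}

/-! ### Neighbourhood types -/

/-- The neighbourhood of `ν`: the vertices `ν'` of the same level and with the same initial vertex
such that `S_ν (Ω j)` and `S_ν' (Ω j')` intersect. -/
def nbhd (F : ℕ → Finset (List E)) (Ω : V → Set M) (ν : LevelVertex V M) :
    Set (LevelVertex V M) :=
  {ν' | ν' ∈ G.vertices F ∧ ν'.level = ν.level ∧ ν'.init = ν.init ∧
    (ν.map '' Ω ν.term ∩ ν'.map '' Ω ν'.term).Nonempty}

/-- The map `σ = (S_σ, i_ν, j_σ, k) ↦ (τ ∘ S_σ, i_ν', j_σ, k')` induced by `τ`. -/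
def transfer (τ : M → M) (ν' σ : LevelVertex V M) : LevelVertex V M :=
  ⟨τ ∘ σ.map, ν'.init, σ.term, ν'.level⟩

/-- Equivalence of vertices. The bijection `τ` of `M` is `S_ν' ∘ S_ν⁻¹`; it induces a bijection
between the neighbourhoods which sends `ν` to `ν'` and preserves terminal vertices, and
corresponding neighbours have the same descendants. -/
def Equivalent (F : ℕ → Finset (List E)) (Ω : V → Set M) (ν ν' : LevelVertex V M) : Prop :=
  ν.term = ν'.term ∧
  ∃ τ : M ≃ M, τ ∘ ν.map = ν'.map ∧
    Set.BijOn (transfer τ ν') (G.nbhd F Ω ν) (G.nbhd F Ω ν') ∧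
    ∀ σ ∈ G.nbhd F Ω ν, ∀ k₀ ≥ 1, ∀ p ≠ [], ∀ j, G.IsPath σ.term p j →
      ((⟨σ.map ∘ G.pathMap p, ν.init, j, ν.level + k₀⟩ : LevelVertex V M) ∈ G.vertices F ↔
        (⟨(transfer τ ν' σ).map ∘ G.pathMap p, ν'.init, j, ν'.level + k₀⟩ : LevelVertex V M)
          ∈ G.vertices F)

theorem equivalent_refl (F : ℕ → Finset (List E)) (Ω : V → Set M) (ν : LevelVertex V M) :
    G.Equivalent F Ω ν ν := by
  refine ⟨rfl, Equiv.refl M, rfl, ?_, fun σ _ k₀ _ p _ j _ => Iff.rfl⟩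
  have h : Set.EqOn id (transfer (Equiv.refl M) ν) (G.nbhd F Ω ν) := by
    rintro σ ⟨-, hl, hi, -⟩
    ext1
    · rfl
    · exact hi
    · rfl
    · exact hl
  exact (Set.bijOn_id _).congr h

theorem transfer_symm {F : ℕ → Finset (List E)} {Ω : V → Set M} {ν σ : LevelVertex V M}
    (ν' : LevelVertex V M) (τ : M ≃ M) (hσ : σ ∈ G.nbhd F Ω ν) :
    transfer τ.symm ν (transfer τ ν' σ) = σ := by
  obtain ⟨-, hl, hi, -⟩ := hσ
  ext1
  · funext x
    simp [transfer]
  · exact hi.symm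
  · rfl
  · exact hl.symm

theorem equivalent_symm (F : ℕ → Finset (List E)) (Ω : V → Set M) {ν ν' : LevelVertex V M}
    (h : G.Equivalent F Ω ν ν') : G.Equivalent F Ω ν' ν := by
  obtain ⟨hj, τ, hτ, hb, hd⟩ := h
  have hinv : Set.InvOn (transfer τ.symm ν) (transfer τ ν') (G.nbhd F Ω ν) (G.nbhd F Ω ν') :=
    ⟨fun σ hσ => G.transfer_symm ν' τ hσ, fun σ hσ => by
      simpa using G.transfer_symm ν τ.symm hσ⟩
  refine ⟨hj.symm, τ.symm, ?_, hb.symm hinv.symm, ?_⟩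
  · rw [← hτ]
    funext x
    simp
  · intro σ' hσ' k₀ hk₀ p hp j hpj
    obtain ⟨σ, hσ, rfl⟩ := hb.surjOn hσ'
    rw [G.transfer_symm ν' τ hσ]
    exact (hd σ hσ k₀ hk₀ p hp j hpj).symm

theorem equivalent_trans (F : ℕ → Finset (List E)) (Ω : V → Set M)
    {ν₁ ν₂ ν₃ : LevelVertex V M} (h : G.Equivalent F Ω ν₁ ν₂) (h' : G.Equivalent F Ω ν₂ ν₃) :
    G.Equivalent F Ω ν₁ ν₃ := by
  obtain ⟨hj, τ, hτ, hb, hd⟩ := h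
  obtain ⟨hj', τ', hτ', hb', hd'⟩ := h'
  refine ⟨hj.trans hj', τ.trans τ', ?_, hb'.comp hb, ?_⟩
  · rw [← hτ', ← hτ]
    rfl
  · intro σ hσ k₀ hk₀ p hp j hpj
    exact (hd σ hσ k₀ hk₀ p hp j hpj).trans (hd' _ (hb.mapsTo hσ) k₀ hk₀ p hp j hpj)

/-- The equivalence relation whose classes are the neighbourhood types. -/
def typeSetoid (F : ℕ → Finset (List E)) (Ω : V → Set M) : Setoid (LevelVertex V M) where
  r := G.Equivalent F Ω
  iseqv := ⟨G.equivalent_refl F Ω, G.equivalent_symm F Ω, G.equivalent_trans F Ω⟩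

/-- The neighbourhood types of the vertices belonging to a set `A` of vertices. -/
abbrev NbhdType (F : ℕ → Finset (List E)) (Ω : V → Set M) (A : Set (LevelVertex V M)) :=
  Quotient ((G.typeSetoid F Ω).comap (Subtype.val : A → LevelVertex V M))

/-- The neighbourhood type of a vertex belonging to `A`. -/
def typeOf (F : ℕ → Finset (List E)) (Ω : V → Set M) {A : Set (LevelVertex V M)} (ν : A) :
    G.NbhdType F Ω A :=
  Quotient.mk _ ν

/-- `Ω` is a graph finite type condition family with respect to the nested index sets `F`: it is
an invariant family of nonempty bounded open sets, and there are only finitely many neighbourhood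
types of vertices. -/
def IsGFTCFamily (F : ℕ → Finset (List E)) (Ω : V → Set M) : Prop :=
  G.IsNested F ∧ G.IsInvariantFamily Ω ∧ Finite (G.NbhdType F Ω (G.vertices F))

/-! ### The weighted incidence matrix -/

/-- The sum of `ρ_w ^ α` over all edges `ν → σ` of the reduced graph, `w` the label of the edge,
such that `σ` has neighbourhood type `T`. -/
def offspringWeight [LinearOrder E] (F : ℕ → Finset (List E)) (Ω : V → Set M) (α : ℝ)
    (ν : G.reducedVertices F) (T : G.NbhdType F Ω (G.reducedVertices F)) : ℝ :=
  ∑ᶠ x : {x : List E × G.reducedVertices F // G.MinEdge F ν x.1 x.2 ∧ G.typeOf F Ω x.2 = T},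
    G.pathRatio x.1.1 ^ α

/-- `A` is the weighted incidence matrix with exponent `α`, for an enumeration `T` of the
neighbourhood types of the reduced graph: its `(i, j)` entry is obtained from any vertex of type
`T i` of the reduced graph (the entry does not depend on the choice of that vertex). -/
def IsWeightedIncidenceMatrix [LinearOrder E] (F : ℕ → Finset (List E)) (Ω : V → Set M)
    {q : ℕ} (T : Fin q ≃ G.NbhdType F Ω (G.reducedVertices F)) (α : ℝ)
    (A : Matrix (Fin q) (Fin q) ℝ) : Prop :=
  ∀ i j, ∀ ν : G.reducedVertices F, G.typeOf F Ω ν = T i → A i j = G.offspringWeight F Ω α ν (T j)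

end SimilitudeGIFS

/-- The spectral radius of a real square matrix: the largest modulus of its complex eigenvalues. -/
def Matrix.realSpectralRadius {q : ℕ} (A : Matrix (Fin q) (Fin q) ℝ) : ENNReal :=
  spectralRadius ℂ (A.map (algebraMap ℝ ℂ))

end

/-! ### Spectral radius of a nonnegative matrix -/

namespace Matrix

attribute [local instance] Matrix.linftyOpNormedRing Matrix.linftyOpNormedAlgebra
  Matrix.linftyOpNormedAddCommGroup Matrix.linftyOpNormedSpace

/-! Keeping only minimal labels makes the reduced graph a forest: the similitudes are onto, so the
last factor of a composition can be cancelled and the parent of a vertex is determined. The size of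
a vertex is the ratio of its map. By the definition of the types, sums of `size ^ β` over the
descendants of a vertex after `k` generations are row sums of `A β ^ k`, and at each generation the
cells `S_ω (K j)` below a root `i` cover `K i`.

Exponent. An edge with empty label does not contract, so monotonicity of the spectral radius in `β`
needs an argument. Sizes tend to zero along every infinite path, hence types cannot form a cycle of
edges without contraction. A weight depending only on the type then turns the size into a potential
that drops by a fixed factor `base > 1` along every edge (`potential_child`), and conjugating by
this weight shows that lowering `β` by `ε` multiplies the spectral radius by at least `base ^ ε`.
Child-to-parent ratios are bounded below, so raising `β` by `ε` costs at most a factor `κ ^ ε`. At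
`β = 0` the radius is at least `1`, since every vertex has a child. Hence there is a unique `α`, and
it is nonnegative (`exists_exponent`).

Upper bound. For `β > α` the powers of `A β` eventually have row sums at most `1`, and the covers by
generations give finite `β`-dimensional measure (`dimH_le`).

Lower bound. The moduli of an eigenvector give `h ≥ 0`, `h ≠ 0` with `A α h ≥ h`. The mass `size ^ α
* h (type)` of a cell is then at most the total mass of its children; neither irreducibility nor a
limit measure is needed. Given a finite cover by balls, the tree is cut at the first cells that are
no larger than some ball they meet. Each ball meets boundedly many of these cells
(`exists_card_bound`): finiteness of types bounds the overlaps of the open sets, and volume in a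
locally Euclidean space does the rest. So `∑ r ^ α` is bounded below and the `α`-dimensional measure
is positive (`exists_le_dimH`). -/

theorem tendsto_norm_pow_realSpectralRadius {q : ℕ} (A : Matrix (Fin q) (Fin q) ℝ) :
    Filter.Tendsto (fun k : ℕ => ENNReal.ofReal (‖(A.map (algebraMap ℝ ℂ)) ^ k‖ ^ (1 / k : ℝ)))
      Filter.atTop (nhds A.realSpectralRadius) := by
  have : CompleteSpace (Matrix (Fin q) (Fin q) ℂ) := FiniteDimensional.complete ℂ _
  exact spectrum.pow_norm_pow_one_div_tendsto_nhds_spectralRadius _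

theorem norm_map_pow {q : ℕ} (A : Matrix (Fin q) (Fin q) ℝ) (k : ℕ) :
    ‖(A.map (algebraMap ℝ ℂ)) ^ k‖ = ‖A ^ k‖ := by
  have h1 : (A.map (algebraMap ℝ ℂ)) ^ k = (A ^ k).map (algebraMap ℝ ℂ) := by
    simpa using (map_pow (algebraMap ℝ ℂ).mapMatrix A k).symm
  rw [h1, linfty_opNorm_def, linfty_opNorm_def]
  simp

/-- A nonnegative matrix has a nonnegative vector `h ≠ 0` with `A h ≥ c h`, for every `c` up to
its spectral radius. -/
theorem exists_le_mulVec {q : ℕ} [NeZero q] {A : Matrix (Fin q) (Fin q) ℝ} (hA : ∀ i j, 0 ≤ A i j)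
    {c : ℝ} (hc : ENNReal.ofReal c ≤ A.realSpectralRadius) :
    ∃ h : Fin q → ℝ, (∀ i, 0 ≤ h i) ∧ h ≠ 0 ∧ ∀ i, c * h i ≤ ∑ j, A i j * h j := by
  have : CompleteSpace (Matrix (Fin q) (Fin q) ℂ) := FiniteDimensional.complete ℂ _
  obtain ⟨z, hz, hzr⟩ := spectrum.exists_nnnorm_eq_spectralRadius (A.map (algebraMap ℝ ℂ))
  have hcz : c ≤ ‖z‖ := by
    have h2 : ENNReal.ofReal c ≤ (‖z‖₊ : ENNReal) := by rw [hzr]; exact hc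
    rw [← enorm_eq_nnnorm, ← ofReal_norm] at h2
    exact (ENNReal.ofReal_le_ofReal_iff (norm_nonneg z)).1 h2
  rw [← Matrix.spectrum_toLin', ← Module.End.hasEigenvalue_iff_mem_spectrum] at hz
  obtain ⟨v, hv⟩ := hz.exists_hasEigenvector
  have hv1 := hv.apply_eq_smul
  rw [Matrix.toLin'_apply] at hv1
  -- The vector of moduli of an eigenvector for an eigenvalue of largest modulus; the triangle
  -- inequality gives the claim without Perron–Frobenius theory.
  refine ⟨fun i => ‖v i‖, fun i => norm_nonneg _, fun h0 => hv.2 ?_, fun i => ?_⟩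
  · funext i
    simpa using congrFun h0 i
  · have h3 := congrFun hv1 i
    calc c * ‖v i‖ ≤ ‖z‖ * ‖v i‖ := by gcongr
      _ = ‖∑ j, (A i j : ℂ) * v j‖ := by
        rw [← norm_mul]
        congr 1
        simpa [Matrix.mulVec, dotProduct] using h3.symm
      _ ≤ ∑ j, ‖(A i j : ℂ) * v j‖ := norm_sum_le _ _
      _ = ∑ j, A i j * ‖v j‖ := by
        refine Finset.sum_congr rfl fun j _ => ?_
        rw [norm_mul, Complex.norm_real, Real.norm_of_nonneg (hA i j)]

theorem mulVec_mono {q : ℕ} {A : Matrix (Fin q) (Fin q) ℝ} (hA : ∀ i j, 0 ≤ A i j)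
    {u v : Fin q → ℝ} (h : ∀ i, u i ≤ v i) (i : Fin q) : (A *ᵥ u) i ≤ (A *ᵥ v) i := by
  simp only [mulVec, dotProduct]
  exact Finset.sum_le_sum fun j _ => mul_le_mul_of_nonneg_left (h j) (hA i j)

/-- Converse of `exists_le_mulVec`: iteration gives `c ^ k h ≤ A ^ k h`, hence `c ^ k ≤ ‖A ^ k‖`,
and Gelfand's formula applies. -/
theorem ofReal_le_realSpectralRadius {q : ℕ} {A : Matrix (Fin q) (Fin q) ℝ}
    (hA : ∀ i j, 0 ≤ A i j) {c : ℝ} (hc : 0 ≤ c) {h : Fin q → ℝ} (h0 : ∀ i, 0 ≤ h i) (hne : h ≠ 0)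
    (hAh : ∀ i, c * h i ≤ ∑ j, A i j * h j) : ENNReal.ofReal c ≤ A.realSpectralRadius := by
  have hk : ∀ k : ℕ, ∀ i, c ^ k * h i ≤ ((A ^ k) *ᵥ h) i := by
    intro k
    induction k with
    | zero => simp
    | succ k ih =>
      intro i
      rw [pow_succ' A, ← Matrix.mulVec_mulVec]
      calc c ^ (k + 1) * h i = c ^ k * (c * h i) := by ring
        _ ≤ c ^ k * (A *ᵥ h) i := by gcongr; exact hAh i
        _ = (A *ᵥ (fun j => c ^ k * h j)) i := by
          simp only [mulVec, dotProduct, Finset.mul_sum]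
          exact Finset.sum_congr rfl fun j _ => by ring
        _ ≤ _ := mulVec_mono hA ih i
  have hnorm : 0 < ‖h‖ := norm_pos_iff.2 hne
  have hle : ∀ k : ℕ, c ^ k ≤ ‖A ^ k‖ := by
    intro k
    have h1 : c ^ k * ‖h‖ ≤ ‖A ^ k‖ * ‖h‖ := by
      calc c ^ k * ‖h‖ = ‖c ^ k • h‖ := by
            rw [norm_smul, Real.norm_of_nonneg (pow_nonneg hc k)]
        _ ≤ ‖(A ^ k) *ᵥ h‖ := by
            refine (pi_norm_le_iff_of_nonneg (norm_nonneg _)).2 fun i => ?_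
            have h2 : 0 ≤ c ^ k * h i := mul_nonneg (pow_nonneg hc k) (h0 i)
            calc ‖(c ^ k • h) i‖ = c ^ k * h i := by
                  simp only [Pi.smul_apply, smul_eq_mul]; exact Real.norm_of_nonneg h2
              _ ≤ ((A ^ k) *ᵥ h) i := hk k i
              _ ≤ ‖((A ^ k) *ᵥ h) i‖ := Real.le_norm_self _
              _ ≤ _ := norm_le_pi_norm _ i
        _ ≤ _ := linfty_opNorm_mulVec _ _
    exact le_of_mul_le_mul_right h1 hnorm
  refine ge_of_tendsto (tendsto_norm_pow_realSpectralRadius A) ?_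
  filter_upwards [Filter.eventually_gt_atTop 0] with k hk0
  refine ENNReal.ofReal_le_ofReal ?_
  rw [norm_map_pow]
  calc c = (c ^ k) ^ (1 / k : ℝ) := by
        rw [one_div, Real.pow_rpow_inv_natCast hc hk0.ne']
    _ ≤ _ := Real.rpow_le_rpow (pow_nonneg hc k) (hle k) (by positivity)

theorem eventually_sum_pow_le_one {q : ℕ} {A : Matrix (Fin q) (Fin q) ℝ}
    (hA : A.realSpectralRadius < 1) :
    ∀ᶠ k : ℕ in Filter.atTop, ∀ i, ∑ j, (A ^ k) i j ≤ 1 := by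
  filter_upwards [(tendsto_norm_pow_realSpectralRadius A).eventually_lt_const hA,
    Filter.eventually_gt_atTop 0] with k hk hk0 i
  rw [norm_map_pow] at hk
  have h1 : ‖A ^ k‖ ≤ 1 := by
    by_contra! hcon
    have h2 : 1 ≤ ‖A ^ k‖ ^ (1 / k : ℝ) := Real.one_le_rpow hcon.le (by positivity)
    exact absurd hk (not_lt.2 (by simpa using ENNReal.ofReal_le_ofReal h2))
  calc ∑ j, (A ^ k) i j = ((A ^ k) *ᵥ (fun _ => 1)) i := by simp [mulVec, dotProduct]
    _ ≤ ‖((A ^ k) *ᵥ (fun _ => (1 : ℝ))) i‖ := Real.le_norm_self _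
    _ ≤ ‖(A ^ k) *ᵥ (fun _ => (1 : ℝ))‖ := norm_le_pi_norm _ i
    _ ≤ ‖A ^ k‖ * ‖(fun _ : Fin q => (1 : ℝ))‖ := linfty_opNorm_mulVec _ _
    _ ≤ 1 * 1 := by
        gcongr
        exact (pi_norm_le_iff_of_nonneg zero_le_one).2 fun i => by simp
    _ = 1 := one_mul 1

end Matrix

/-! ### Trees with finitely many types -/

/-- A forest in which every vertex `x` carries one of `q` types and a positive number `ratio x`, such
that the sums of `(ratio y / ratio x) ^ β` over the children `y` of `x` of a given type depend
only on the type of `x`. -/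
structure TypedForest (X : Type*) (q : ℕ) where
  /-- the children of a vertex -/
  children : X → Finset X
  /-- the generation of a vertex -/
  level : X → ℕ
  /-- the type of a vertex -/
  type : X → Fin q
  /-- the size of a vertex -/
  ratio : X → ℝ
  /-- the matrices of sums over children of given type -/
  mat : ℝ → Matrix (Fin q) (Fin q) ℝ
  /-- a bound for the contraction along those edges which contract at all -/
  gap : ℝ
  gap_pos : 0 < gap
  gap_lt_one : gap < 1
  ratio_pos : ∀ x, 0 < ratio x
  children_nonempty : ∀ x, (children x).Nonempty
  level_child : ∀ x, ∀ y ∈ children x, level y = level x + 1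
  parent_unique : ∀ x x' y, y ∈ children x → y ∈ children x' → x = x'
  type_surjective : Function.Surjective type
  mat_apply : ∀ β x j, mat β (type x) j =
    ∑ y ∈ (children x).filter (fun y => type y = j), (ratio y / ratio x) ^ β
  ratio_child : ∀ x, ∀ y ∈ children x, ratio y = ratio x ∨ ratio y ≤ gap * ratio x
  tendsto_ratio : ∀ s : ℕ → X, (∀ m, s (m + 1) ∈ children (s m)) →
    Filter.Tendsto (fun m => ratio (s m)) Filter.atTop (nhds 0)

namespace TypedForest

open Filter Finset

variable {X : Type*} {q : ℕ} (P : TypedForest X q)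

/-- The dictionary between matrices and trees: applying `mat β` to a function of the type is a
weighted sum over children. -/
theorem sum_children (β : ℝ) (g : Fin q → ℝ) (x : X) :
    ∑ j, P.mat β (P.type x) j * g j =
      ∑ y ∈ P.children x, (P.ratio y / P.ratio x) ^ β * g (P.type y) := by
  rw [← Finset.sum_fiberwise (P.children x) P.type]
  refine Finset.sum_congr rfl fun j _ => ?_
  rw [P.mat_apply, Finset.sum_mul]
  refine Finset.sum_congr rfl fun y hy => ?_
  rw [(Finset.mem_filter.1 hy).2]

theorem div_pos (x y : X) : 0 < P.ratio y / P.ratio x := _root_.div_pos (P.ratio_pos y) (P.ratio_pos x)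

theorem mat_nonneg (β : ℝ) (i j : Fin q) : 0 ≤ P.mat β i j := by
  obtain ⟨x, rfl⟩ := P.type_surjective i
  rw [P.mat_apply]
  exact Finset.sum_nonneg fun y _ => Real.rpow_nonneg (P.div_pos x y).le _

theorem rpow_le_mat {x y : X} (hy : y ∈ P.children x) (β : ℝ) :
    (P.ratio y / P.ratio x) ^ β ≤ P.mat β (P.type x) (P.type y) := by
  rw [P.mat_apply]
  exact Finset.single_le_sum (f := fun y => (P.ratio y / P.ratio x) ^ β)
    (fun z _ => Real.rpow_nonneg (P.div_pos x z).le _) (Finset.mem_filter.2 ⟨hy, rfl⟩)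

/-- The ratios of children to parents are bounded from below. -/
theorem exists_le_ratio : ∃ κ : ℝ, 0 < κ ∧ κ ≤ 1 ∧
    ∀ x, ∀ y ∈ P.children x, κ * P.ratio x ≤ P.ratio y := by
  -- With exponent `-1`, each quotient parent/child is one summand of a matrix entry, so it is
  -- bounded by the sum of all entries.
  set S := ∑ i, ∑ j, P.mat (-1) i j with hS
  have hS0 : 0 ≤ S := Finset.sum_nonneg fun i _ => Finset.sum_nonneg fun j _ => P.mat_nonneg _ _ _
  refine ⟨(1 + S)⁻¹, by positivity, inv_le_one_of_one_le₀ (by linarith), fun x y hy => ?_⟩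
  have h1 := P.rpow_le_mat hy (-1)
  have h2 : P.mat (-1) (P.type x) (P.type y) ≤ S :=
    (Finset.single_le_sum (f := fun j => P.mat (-1) (P.type x) j)
      (fun j _ => P.mat_nonneg _ _ _) (Finset.mem_univ (P.type y))).trans
    (Finset.single_le_sum (f := fun i => ∑ j, P.mat (-1) i j)
      (fun i _ => Finset.sum_nonneg fun j _ => P.mat_nonneg _ _ _) (Finset.mem_univ (P.type x)))
  rw [Real.rpow_neg_one, inv_div] at h1
  have h3 : P.ratio x ≤ (1 + S) * P.ratio y := by
    rw [← div_le_iff₀ (P.ratio_pos y)]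
    linarith
  rwa [inv_mul_le_iff₀ (by positivity)]

/-- The number of children is bounded. -/
theorem exists_card_le : ∃ B : ℕ, 0 < B ∧ ∀ x, (P.children x).card ≤ B := by
  set S := ∑ i, ∑ j, P.mat 0 i j with hS
  obtain ⟨B, hB⟩ := exists_nat_ge S
  refine ⟨B + 1, B.succ_pos, fun x => ?_⟩
  -- With exponent `0`, row sums count children.
  have h1 : ((P.children x).card : ℝ) = ∑ j, P.mat 0 (P.type x) j := by
    simpa using (P.sum_children 0 (fun _ => 1) x).symm
  have h2 : ∑ j, P.mat 0 (P.type x) j ≤ S :=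
    Finset.single_le_sum (f := fun i => ∑ j, P.mat 0 i j)
      (fun i _ => Finset.sum_nonneg fun j _ => P.mat_nonneg _ _ _) (Finset.mem_univ (P.type x))
  have h3 : ((P.children x).card : ℝ) ≤ (B : ℝ) := by linarith
  exact (Nat.cast_le.1 h3).trans B.le_succ

/-! #### The potential -/

/-- Vertices of type `i` have a child of type `j` of the same size. -/
def Flat (i j : Fin q) : Prop := ∀ β : ℝ, 0 ≤ β → 1 ≤ P.mat β i j

theorem flat_of_ratio_eq {x y : X} (hy : y ∈ P.children x) (h : P.ratio y = P.ratio x) :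
    P.Flat (P.type x) (P.type y) := by
  intro β _
  have := P.rpow_le_mat hy β
  rwa [h, div_self (P.ratio_pos x).ne', Real.one_rpow] at this

/-- If all children of type `j` contracted, the entry would be at most `card * gap ^ β`, which tends
to `0` as `β` grows. So the matrices alone detect edges without contraction. -/
theorem Flat.exists_child {x : X} {j : Fin q} (h : P.Flat (P.type x) j) :
    ∃ y ∈ P.children x, P.type y = j ∧ P.ratio y = P.ratio x := by
  by_contra! hcon
  have hle : ∀ β : ℝ, 0 ≤ β → 1 ≤ ((P.children x).card : ℝ) * P.gap ^ β := by
    intro β hβ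
    refine (h β hβ).trans ?_
    rw [P.mat_apply]
    calc ∑ y ∈ (P.children x).filter (fun y => P.type y = j), (P.ratio y / P.ratio x) ^ β
        ≤ ∑ y ∈ (P.children x).filter (fun y => P.type y = j), P.gap ^ β := by
          refine Finset.sum_le_sum fun y hy => ?_
          obtain ⟨hy1, hy2⟩ := Finset.mem_filter.1 hy
          refine Real.rpow_le_rpow (P.div_pos x y).le ?_ hβ
          rw [div_le_iff₀ (P.ratio_pos x)]
          exact (P.ratio_child x y hy1).resolve_left (hcon y hy1 hy2)
      _ = (((P.children x).filter (fun y => P.type y = j)).card : ℝ) * P.gap ^ β := by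
          rw [Finset.sum_const, nsmul_eq_mul]
      _ ≤ _ := by
          gcongr
          · exact Real.rpow_nonneg P.gap_pos.le _
          · exact Finset.filter_subset _ _
  have hlim : Tendsto (fun k : ℕ => ((P.children x).card : ℝ) * P.gap ^ k) atTop (nhds 0) := by
    simpa using (tendsto_pow_atTop_nhds_zero_of_lt_one P.gap_pos.le P.gap_lt_one).const_mul
      ((P.children x).card : ℝ)
  obtain ⟨k, hk⟩ := (hlim.eventually_lt_const one_pos).exists
  have := hle k (Nat.cast_nonneg k)
  rw [Real.rpow_natCast] at this
  linarith

/-- The child relation restricted to edges without contraction. -/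
def FlatChild (y x : X) : Prop := y ∈ P.children x ∧ P.ratio y = P.ratio x

theorem wellFounded_flatChild : WellFounded P.FlatChild := by
  rw [wellFounded_iff_isEmpty_descending_chain]
  refine ⟨fun ⟨s, hs⟩ => ?_⟩
  have h1 : ∀ m, P.ratio (s m) = P.ratio (s 0) := by
    intro m
    induction m with
    | zero => rfl
    | succ m ih => rw [(hs m).2, ih]
  have h2 := P.tendsto_ratio s fun m => (hs m).1
  simp only [h1] at h2
  exact (P.ratio_pos (s 0)).ne' (tendsto_nhds_unique tendsto_const_nhds h2)

theorem exists_of_transGen_flat {i j : Fin q} (h : Relation.TransGen P.Flat i j) (x : X)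
    (hx : P.type x = i) : ∃ y, P.type y = j ∧ Relation.TransGen P.FlatChild y x := by
  induction h with
  | single h =>
    subst hx
    obtain ⟨y, hy, hyj, hyr⟩ := h.exists_child
    exact ⟨y, hyj, .single ⟨hy, hyr⟩⟩
  | tail _ h ih =>
    obtain ⟨y, rfl, hyx⟩ := ih
    obtain ⟨z, hz, hzj, hzr⟩ := h.exists_child
    exact ⟨z, hzj, .head ⟨hz, hzr⟩ hyx⟩

/-- A cycle of types could be lifted to the forest starting from any vertex of type `i`, in
particular from one that is minimal for the well-founded relation `FlatChild`. -/
theorem not_transGen_flat_self (i : Fin q) : ¬ Relation.TransGen P.Flat i i := by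
  intro h
  obtain ⟨x, hx⟩ := P.type_surjective i
  obtain ⟨m, hm, hmin⟩ := P.wellFounded_flatChild.transGen.has_min {x | P.type x = i} ⟨x, hx⟩
  obtain ⟨y, hy, hym⟩ := P.exists_of_transGen_flat h m hm
  exact hmin y hy hym

/-- The number of types that can be reached along edges without contraction. -/
noncomputable def rank (i : Fin q) : ℕ := {j | Relation.TransGen P.Flat i j}.ncard

theorem rank_le (i : Fin q) : P.rank i ≤ q := by
  simpa [rank] using Set.ncard_le_ncard (Set.subset_univ {j | Relation.TransGen P.Flat i j})

theorem rank_lt {i j : Fin q} (h : P.Flat i j) : P.rank j < P.rank i := by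
  refine Set.ncard_lt_ncard ⟨fun k hk => .head h hk, fun hsub => ?_⟩ (Set.toFinite _)
  exact P.not_transGen_flat_self j (hsub (.single h))

/-- The factor by which the potential decreases along every edge. -/
noncomputable def base : ℝ := P.gap⁻¹ ^ ((q + 1 : ℝ)⁻¹)

theorem one_lt_base : 1 < P.base :=
  Real.one_lt_rpow (one_lt_inv₀ P.gap_pos |>.2 P.gap_lt_one) (by positivity)

theorem base_pow : P.base ^ (q + 1) = P.gap⁻¹ := by
  have := Real.rpow_inv_natCast_pow (inv_nonneg.2 P.gap_pos.le) q.succ_ne_zero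
  simpa [base] using this

/-- An edge without contraction lowers the rank by at least one. Any other edge shrinks the size by
`gap = base ^ (-(q + 1))`, which pays for a rank increase of at most `q` and leaves one factor
`base`. -/
theorem potential_child {x y : X} (hy : y ∈ P.children x) :
    P.base * (P.base ^ P.rank (P.type y) * P.ratio y) ≤
      P.base ^ P.rank (P.type x) * P.ratio x := by
  have hb := P.one_lt_base
  have hb0 : 0 < P.base := one_pos.trans hb
  rw [← mul_assoc, ← pow_succ']
  by_cases h : P.ratio y = P.ratio x
  · rw [h]
    exact mul_le_mul_of_nonneg_right
      (pow_le_pow_right₀ hb.le (P.rank_lt (P.flat_of_ratio_eq hy h))) (P.ratio_pos x).le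
  · have h1 := (P.ratio_child x y hy).resolve_left h
    calc P.base ^ (P.rank (P.type y) + 1) * P.ratio y
        ≤ P.base ^ (q + 1) * (P.gap * P.ratio x) := by
          have h2 : P.rank (P.type y) + 1 ≤ q + 1 := Nat.succ_le_succ (P.rank_le _)
          have := P.ratio_pos y
          gcongr
          exact hb.le
      _ = P.ratio x := by
          rw [P.base_pow, ← mul_assoc, inv_mul_cancel₀ P.gap_pos.ne', one_mul]
      _ ≤ _ := le_mul_of_one_le_left (P.ratio_pos x).le (one_le_pow₀ hb.le)

/-! #### The exponent -/

/-- `mat β` has a nonnegative nonzero vector which it multiplies at least by `c`. -/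
def Sub (β c : ℝ) : Prop :=
  ∃ h : Fin q → ℝ, (∀ i, 0 ≤ h i) ∧ h ≠ 0 ∧ ∀ i, c * h i ≤ ∑ j, P.mat β i j * h j

variable {P}

theorem Sub.mono {β c c' : ℝ} (h : P.Sub β c) (hc : c' ≤ c) : P.Sub β c' := by
  obtain ⟨h, h0, hne, hle⟩ := h
  exact ⟨h, h0, hne, fun i => (mul_le_mul_of_nonneg_right hc (h0 i)).trans (hle i)⟩

/-- Divide the vector by the weight `base ^ (rank * ε)` and use the `ε`-th power of
`potential_child`. This is the strict monotonicity in the exponent. -/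
theorem Sub.shift_left {β ε c : ℝ} (hε : 0 ≤ ε) (h : P.Sub (β + ε) c) :
    P.Sub β (c * P.base ^ ε) := by
  obtain ⟨h, h0, hne, hle⟩ := h
  have hb0 : 0 < P.base := one_pos.trans P.one_lt_base
  set w : Fin q → ℝ := fun i => (P.base ^ P.rank i) ^ ε with hw
  have hw0 : ∀ i, 0 < w i := fun i => Real.rpow_pos_of_pos (pow_pos hb0 _) _
  have hbe : 0 < P.base ^ ε := Real.rpow_pos_of_pos hb0 _
  refine ⟨fun i => h i / w i, fun i => div_nonneg (h0 i) (hw0 i).le, fun h1 => hne ?_, fun i => ?_⟩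
  · funext i
    have := congrFun h1 i
    simpa [(hw0 i).ne'] using this
  · obtain ⟨x, rfl⟩ := P.type_surjective i
    have h1 := hle (P.type x)
    rw [P.sum_children] at h1 ⊢
    have hkey : ∀ y ∈ P.children x, (P.ratio y / P.ratio x) ^ (β + ε) * h (P.type y) ≤
        (w (P.type x) / P.base ^ ε) *
          ((P.ratio y / P.ratio x) ^ β * (h (P.type y) / w (P.type y))) := by
      intro y hy
      have h2 : (P.ratio y / P.ratio x) ^ ε * (P.base ^ ε * w (P.type y)) ≤ w (P.type x) := by
        rw [hw, ← Real.mul_rpow hb0.le (by positivity),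
          ← Real.mul_rpow (P.div_pos x y).le (by positivity)]
        refine Real.rpow_le_rpow ?_ ?_ hε
        · exact mul_nonneg (P.div_pos x y).le (by positivity)
        · rw [div_mul_eq_mul_div, div_le_iff₀ (P.ratio_pos x)]
          calc _ = P.base * (P.base ^ P.rank (P.type y) * P.ratio y) := by ring
            _ ≤ _ := P.potential_child hy
      have h3 : (P.ratio y / P.ratio x) ^ ε ≤ w (P.type x) / (P.base ^ ε * w (P.type y)) := by
        rw [le_div_iff₀ (mul_pos hbe (hw0 _))]
        exact h2
      rw [Real.rpow_add (P.div_pos x y)]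
      calc (P.ratio y / P.ratio x) ^ β * (P.ratio y / P.ratio x) ^ ε * h (P.type y)
          ≤ (P.ratio y / P.ratio x) ^ β * (w (P.type x) / (P.base ^ ε * w (P.type y))) *
            h (P.type y) := by
            have := h0 (P.type y)
            have := Real.rpow_nonneg (P.div_pos x y).le β
            gcongr
        _ = _ := by
            have := (hw0 (P.type y)).ne'
            field_simp
    have h4 := h1.trans (Finset.sum_le_sum hkey)
    rw [← Finset.mul_sum] at h4
    have h5 := mul_le_mul_of_nonneg_left h4 (div_nonneg hbe.le (hw0 (P.type x)).le)
    have hx := (hw0 (P.type x)).ne'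
    calc _ = P.base ^ ε / w (P.type x) * (c * h (P.type x)) := by ring
      _ ≤ _ := h5
      _ = _ := by field_simp

/-- Every quotient child/parent is at least `κ`, so the same vector works with the loss `κ ^ ε`.
This plays the role of continuity in the exponent. -/
theorem Sub.shift_right {κ : ℝ} (hκ : 0 < κ)
    (hκP : ∀ x, ∀ y ∈ P.children x, κ * P.ratio x ≤ P.ratio y) {β ε c : ℝ} (hε : 0 ≤ ε)
    (h : P.Sub β c) : P.Sub (β + ε) (c * κ ^ ε) := by
  obtain ⟨h, h0, hne, hle⟩ := h
  refine ⟨h, h0, hne, fun i => ?_⟩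
  obtain ⟨x, rfl⟩ := P.type_surjective i
  have h1 := mul_le_mul_of_nonneg_right (hle (P.type x)) (Real.rpow_nonneg hκ.le ε)
  rw [P.sum_children] at h1 ⊢
  calc _ = c * h (P.type x) * κ ^ ε := by ring
    _ ≤ _ := h1
    _ ≤ _ := by
      rw [Finset.sum_mul]
      refine Finset.sum_le_sum fun y hy => ?_
      rw [Real.rpow_add (P.div_pos x y)]
      have h2 : κ ^ ε ≤ (P.ratio y / P.ratio x) ^ ε := by
        refine Real.rpow_le_rpow hκ.le ?_ hε
        rw [le_div_iff₀ (P.ratio_pos x)]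
        exact hκP x y hy
      have := h0 (P.type y)
      have := Real.rpow_nonneg (P.div_pos x y).le β
      calc _ = (P.ratio y / P.ratio x) ^ β * κ ^ ε * h (P.type y) := by ring
        _ ≤ _ := by gcongr

theorem sub_zero_one [NeZero q] : P.Sub 0 1 := by
  refine ⟨fun _ => 1, fun _ => zero_le_one, fun h => ?_, fun i => ?_⟩
  · simpa using congrFun h 0
  · obtain ⟨x, rfl⟩ := P.type_surjective i
    rw [P.sum_children]
    simpa using (P.children_nonempty x)

/-- Evaluate the inequality at a largest coordinate of the vector. -/
theorem exists_forall_sub_le [NeZero q] (β : ℝ) : ∃ B : ℝ, ∀ c, P.Sub β c → c ≤ B := by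
  refine ⟨∑ i, ∑ j, P.mat β i j, fun c ⟨h, h0, hne, hle⟩ => ?_⟩
  obtain ⟨i, hi⟩ := Finite.exists_max h
  have hi0 : 0 < h i := by
    refine lt_of_le_of_ne (h0 i) fun h1 => hne ?_
    funext j
    exact le_antisymm ((hi j).trans h1.symm.le) (h0 j)
  have h1 : c * h i ≤ (∑ j, P.mat β i j) * h i := by
    rw [Finset.sum_mul]
    exact (hle i).trans (Finset.sum_le_sum fun j _ =>
      mul_le_mul_of_nonneg_left (hi j) (P.mat_nonneg _ _ _))
  exact (le_of_mul_le_mul_right h1 hi0).trans (Finset.single_le_sum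
    (f := fun i => ∑ j, P.mat β i j)
    (fun i _ => Finset.sum_nonneg fun j _ => P.mat_nonneg _ _ _) (Finset.mem_univ i))

theorem ofReal_le_realSpectralRadius_iff [NeZero q] {β c : ℝ} (hc : 0 ≤ c) :
    ENNReal.ofReal c ≤ (P.mat β).realSpectralRadius ↔ P.Sub β c :=
  ⟨fun h => Matrix.exists_le_mulVec (P.mat_nonneg β) h, fun ⟨_, h0, hne, hle⟩ =>
    Matrix.ofReal_le_realSpectralRadius (P.mat_nonneg β) hc h0 hne hle⟩

theorem one_le_realSpectralRadius_iff [NeZero q] {β : ℝ} :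
    1 ≤ (P.mat β).realSpectralRadius ↔ P.Sub β 1 := by
  rw [← ofReal_le_realSpectralRadius_iff zero_le_one, ENNReal.ofReal_one]

variable (P)

/-- There is exactly one exponent for which the spectral radius is `1`; it is nonnegative, and the
spectral radius is smaller than `1` for larger exponents. -/
theorem exists_exponent [NeZero q] : ∃ α : ℝ, 0 ≤ α ∧
    (∀ β, (P.mat β).realSpectralRadius = 1 ↔ β = α) ∧ P.Sub α 1 ∧
    ∀ β, α < β → (P.mat β).realSpectralRadius < 1 := by
  -- The exponent is the supremum of all `β` with spectral radius at least `1`. This set is bounded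
  -- because `β` in it forces the factor `base ^ β` at exponent `0`.
  obtain ⟨κ, hκ, hκ1, hκP⟩ := P.exists_le_ratio
  have hb := P.one_lt_base
  set S : Set ℝ := {β | P.Sub β 1} with hS
  have h0S : (0 : ℝ) ∈ S := sub_zero_one
  have hbdd : BddAbove S := by
    obtain ⟨B, hB⟩ := P.exists_forall_sub_le 0
    obtain ⟨k, hk⟩ := pow_unbounded_of_one_lt B hb
    refine ⟨k, fun β hβ => ?_⟩
    by_contra! hcon
    have hβ0 : 0 ≤ β := (Nat.cast_nonneg k).trans hcon.le
    have h1 : P.Sub 0 (1 * P.base ^ β) := Sub.shift_left hβ0 (by rwa [zero_add])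
    have h2 := hB _ h1
    have h3 : P.base ^ k ≤ P.base ^ β := by
      rw [← Real.rpow_natCast]
      exact Real.rpow_le_rpow_of_exponent_le hb.le hcon.le
    linarith
  set α := sSup S with hα
  have hκlim : Tendsto (fun m : ℕ => κ ^ ((1 : ℝ) / (m + 1))) atTop (nhds 1) := by
    have h1 := (Real.continuous_const_rpow hκ.ne').tendsto 0
    rw [Real.rpow_zero] at h1
    exact h1.comp tendsto_one_div_add_atTop_nhds_zero_nat
  -- Exponents of the set within `1 / (m + 1)` of `α` are shifted to `α`, with a loss tending to
  -- `1`.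
  have hge : 1 ≤ (P.mat α).realSpectralRadius := by
    have h1 : Tendsto (fun m : ℕ => ENNReal.ofReal (κ ^ ((1 : ℝ) / (m + 1)))) atTop (nhds 1) := by
      have h2 := (ENNReal.continuous_ofReal.tendsto 1).comp hκlim
      rwa [ENNReal.ofReal_one] at h2
    refine le_of_tendsto' h1 fun m => ?_
    have hm : (0 : ℝ) < 1 / (m + 1) := Nat.one_div_pos_of_nat
    obtain ⟨β, hβ, hβ1⟩ := exists_lt_of_lt_csSup ⟨0, h0S⟩ (sub_lt_self α hm)
    have hβα : β ≤ α := le_csSup hbdd hβ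
    rw [ofReal_le_realSpectralRadius_iff (Real.rpow_nonneg hκ.le _)]
    have h2 := Sub.shift_right hκ hκP (sub_nonneg.2 hβα) hβ
    rw [add_sub_cancel, one_mul] at h2
    exact h2.mono (Real.rpow_le_rpow_of_exponent_ge hκ hκ1 (by linarith))
  have hαS : P.Sub α 1 := one_le_realSpectralRadius_iff.1 hge
  -- A radius above `1` would survive a small shift to the right, beyond the supremum.
  have hle : (P.mat α).realSpectralRadius ≤ 1 := by
    by_contra! hcon
    obtain ⟨c, hc1, hc2⟩ := ENNReal.lt_iff_exists_nnreal_btwn.1 hcon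
    have hc1' : (1 : ℝ) < c := by exact_mod_cast hc1
    have h1 : P.Sub α c := by
      refine (ofReal_le_realSpectralRadius_iff c.2).1 ?_
      exact ENNReal.ofReal_coe_nnreal.le.trans hc2.le
    have h2 : Tendsto (fun m : ℕ => (c : ℝ) * κ ^ ((1 : ℝ) / (m + 1))) atTop (nhds c) := by
      simpa using hκlim.const_mul (c : ℝ)
    obtain ⟨m, hm⟩ := (h2.eventually_const_lt hc1').exists
    have hm0 : (0 : ℝ) < 1 / (m + 1) := Nat.one_div_pos_of_nat
    have h3 := (Sub.shift_right hκ hκP hm0.le h1).mono hm.le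
    have h4 := le_csSup hbdd h3
    linarith
  refine ⟨α, le_csSup hbdd h0S, fun β => ⟨fun h => ?_, fun h => h ▸ le_antisymm hle hge⟩, hαS,
    fun β hβ => ?_⟩
  · rcases lt_trichotomy β α with hlt | heq | hgt
    · have h1 : P.Sub β (1 * P.base ^ (α - β)) :=
        Sub.shift_left (sub_nonneg.2 hlt.le) (by rwa [add_sub_cancel])
      have h2 : 1 < 1 * P.base ^ (α - β) := by
        rw [one_mul]
        exact Real.one_lt_rpow hb (sub_pos.2 hlt)
      have h3 := (ofReal_le_realSpectralRadius_iff (zero_le_one.trans h2.le)).2 h1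
      rw [h] at h3
      exact absurd h2 (not_lt.2 (ENNReal.ofReal_le_one.1 h3))
    · exact heq
    · exact absurd (le_csSup hbdd (one_le_realSpectralRadius_iff.1 h.ge)) (not_le.2 hgt)
  · by_contra! hcon
    exact absurd (le_csSup hbdd (one_le_realSpectralRadius_iff.1 hcon)) (not_le.2 hβ)

/-! #### Descendants -/

open Classical in
/-- The descendants after `k` generations. -/
noncomputable def descendants : ℕ → X → Finset X
  | 0, x => {x}
  | k + 1, x => (P.children x).biUnion (descendants k)

theorem mem_descendants_zero {x y : X} : y ∈ P.descendants 0 x ↔ y = x := by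
  simp [descendants]

theorem mem_descendants_succ {k : ℕ} {x y : X} :
    y ∈ P.descendants (k + 1) x ↔ ∃ z ∈ P.children x, y ∈ P.descendants k z := by
  simp [descendants]

theorem mem_descendants_succ' {k : ℕ} {x y : X} :
    y ∈ P.descendants (k + 1) x ↔ ∃ z ∈ P.descendants k x, y ∈ P.children z := by
  induction k generalizing x with
  | zero => simp [mem_descendants_succ, mem_descendants_zero]
  | succ k ih =>
    rw [mem_descendants_succ]
    simp_rw [ih, P.mem_descendants_succ (k := k)]
    exact ⟨fun ⟨z, hz, u, hu, hy⟩ => ⟨u, ⟨z, hz, hu⟩, hy⟩,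
      fun ⟨u, ⟨z, hz, hu⟩, hy⟩ => ⟨z, hz, u, hu, hy⟩⟩

theorem mem_descendants_add {k m : ℕ} {x y : X} :
    y ∈ P.descendants (k + m) x ↔ ∃ z ∈ P.descendants k x, y ∈ P.descendants m z := by
  induction k generalizing x with
  | zero => simp [mem_descendants_zero]
  | succ k ih =>
    rw [Nat.add_right_comm, mem_descendants_succ]
    simp_rw [ih, P.mem_descendants_succ (k := k)]
    exact ⟨fun ⟨z, hz, u, hu, hy⟩ => ⟨u, ⟨z, hz, hu⟩, hy⟩,
      fun ⟨u, ⟨z, hz, hu⟩, hy⟩ => ⟨z, hz, u, hu, hy⟩⟩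

theorem level_descendant {k : ℕ} {x y : X} (h : y ∈ P.descendants k x) :
    P.level y = P.level x + k := by
  induction k generalizing x with
  | zero => rw [P.mem_descendants_zero.1 h, add_zero]
  | succ k ih =>
    obtain ⟨z, hz, hy⟩ := P.mem_descendants_succ.1 h
    rw [ih hy, P.level_child x z hz]
    ring

theorem eq_of_mem_descendants {k : ℕ} {x x' y : X} (h : y ∈ P.descendants k x)
    (h' : y ∈ P.descendants k x') : x = x' := by
  induction k generalizing x x' with
  | zero => rw [← P.mem_descendants_zero.1 h, ← P.mem_descendants_zero.1 h']
  | succ k ih =>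
    obtain ⟨z, hz, hy⟩ := P.mem_descendants_succ.1 h
    obtain ⟨z', hz', hy'⟩ := P.mem_descendants_succ.1 h'
    obtain rfl := ih hy hy'
    exact P.parent_unique _ _ _ hz hz'

theorem card_descendants_le {B : ℕ} (hB : ∀ x, (P.children x).card ≤ B) (k : ℕ) (x : X) :
    (P.descendants k x).card ≤ B ^ k := by
  classical
  induction k generalizing x with
  | zero => simp [descendants]
  | succ k ih =>
    rw [descendants, pow_succ']
    exact (Finset.card_biUnion_le_card_mul _ _ _ fun z _ => ih z).trans
      (Nat.mul_le_mul_right _ (hB x))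

/-- Iterated `potential_child`. The factor `base ^ q` is the price for replacing the potential by
the size, as ranks lie between `0` and `q`. -/
theorem ratio_descendant_le {k : ℕ} {x y : X} (h : y ∈ P.descendants k x) :
    P.base ^ k * P.ratio y ≤ P.base ^ q * P.ratio x := by
  have hb := P.one_lt_base
  have hb0 : 0 < P.base := one_pos.trans hb
  have key : P.base ^ k * (P.base ^ P.rank (P.type y) * P.ratio y) ≤
      P.base ^ P.rank (P.type x) * P.ratio x := by
    induction k generalizing x with
    | zero => rw [P.mem_descendants_zero.1 h, pow_zero, one_mul]
    | succ k ih =>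
      obtain ⟨z, hz, hy⟩ := P.mem_descendants_succ.1 h
      calc _ = P.base * (P.base ^ k * (P.base ^ P.rank (P.type y) * P.ratio y)) := by ring
        _ ≤ P.base * (P.base ^ P.rank (P.type z) * P.ratio z) := by
          exact mul_le_mul_of_nonneg_left (ih hy) hb0.le
        _ ≤ _ := P.potential_child hz
  calc P.base ^ k * P.ratio y ≤ P.base ^ k * (P.base ^ P.rank (P.type y) * P.ratio y) := by
        gcongr
        exact le_mul_of_one_le_left (P.ratio_pos y).le (one_le_pow₀ hb.le)
    _ ≤ _ := key
    _ ≤ _ := by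
        have := (P.ratio_pos x).le
        gcongr
        · exact hb.le
        · exact P.rank_le _

theorem sum_descendants_le (β : ℝ) (k : ℕ) (x : X) :
    ∑ y ∈ P.descendants k x, P.ratio y ^ β ≤
      P.ratio x ^ β * ∑ j, (P.mat β ^ k) (P.type x) j := by
  classical
  induction k generalizing x with
  | zero => simp [descendants, Matrix.one_apply]
  | succ k ih =>
    have hx : 0 < P.ratio x ^ β := Real.rpow_pos_of_pos (P.ratio_pos x) _
    calc ∑ y ∈ P.descendants (k + 1) x, P.ratio y ^ β
        ≤ ∑ z ∈ P.children x, ∑ y ∈ P.descendants k z, P.ratio y ^ β := by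
          rw [descendants, Finset.sum_biUnion]
          exact fun z _ z' _ hne => Finset.disjoint_left.2 fun y hy hy' =>
            hne (P.eq_of_mem_descendants hy hy')
      _ ≤ ∑ z ∈ P.children x, P.ratio z ^ β * ∑ j, (P.mat β ^ k) (P.type z) j :=
          Finset.sum_le_sum fun z _ => ih z
      _ = P.ratio x ^ β * ∑ z ∈ P.children x,
            (P.ratio z / P.ratio x) ^ β * ∑ j, (P.mat β ^ k) (P.type z) j := by
          rw [Finset.mul_sum]
          refine Finset.sum_congr rfl fun z _ => ?_
          rw [Real.div_rpow (P.ratio_pos z).le (P.ratio_pos x).le]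
          field_simp
      _ = _ := by
          rw [← P.sum_children β (fun i => ∑ j, (P.mat β ^ k) i j), pow_succ']
          congr 1
          simp only [Matrix.mul_apply, Finset.mul_sum]
          exact Finset.sum_comm

open Classical in
/-- Cutting the tree below `x₀` at the first vertices where `cutAt` holds. -/
theorem exists_cut {m : X → ℝ} (hm : ∀ x, m x ≤ ∑ y ∈ P.children x, m y) (cutAt : X → Prop)
    (N : ℕ) (x₀ : X) (hN : ∀ y ∈ P.descendants N x₀, cutAt y) :
    ∃ C : Finset X, m x₀ ≤ ∑ y ∈ C, m y ∧ ∀ y ∈ C, cutAt y ∧ ∃ k, y ∈ P.descendants k x₀ ∧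
      (y = x₀ ∨ ∃ z, (∃ k, z ∈ P.descendants k x₀) ∧ y ∈ P.children z ∧ ¬ cutAt z) := by
  induction N generalizing x₀ with
  | zero =>
    refine ⟨{x₀}, by simp, fun y hy => ?_⟩
    rw [Finset.mem_singleton] at hy
    subst hy
    have h0 : y ∈ P.descendants 0 y := P.mem_descendants_zero.2 rfl
    exact ⟨hN y h0, 0, h0, .inl rfl⟩
  | succ N ih =>
    have h0 : x₀ ∈ P.descendants 0 x₀ := P.mem_descendants_zero.2 rfl
    by_cases hs : cutAt x₀
    · refine ⟨{x₀}, by simp, fun y hy => ?_⟩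
      rw [Finset.mem_singleton] at hy
      subst hy
      exact ⟨hs, 0, h0, .inl rfl⟩
    · choose! C hC hC' using fun (z : X) (hz : z ∈ P.children x₀) =>
        ih z fun y hy => hN y (P.mem_descendants_succ.2 ⟨z, hz, hy⟩)
      refine ⟨(P.children x₀).biUnion C, ?_, fun y hy => ?_⟩
      · rw [Finset.sum_biUnion]
        · exact (hm x₀).trans (Finset.sum_le_sum hC)
        · intro z hz z' hz' hne
          refine Finset.disjoint_left.2 fun y hy hy' => hne ?_
          obtain ⟨-, k, hk, -⟩ := hC' z hz y hy
          obtain ⟨-, k', hk', -⟩ := hC' z' hz' y hy'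
          have h1 := P.level_descendant hk
          have h2 := P.level_descendant hk'
          rw [P.level_child x₀ z hz] at h1
          rw [P.level_child x₀ z' hz'] at h2
          obtain rfl : k = k' := by omega
          exact P.eq_of_mem_descendants hk hk'
      · obtain ⟨z, hz, hy⟩ := Finset.mem_biUnion.1 hy
        obtain ⟨h1, k, hk, h3⟩ := hC' z hz y hy
        refine ⟨h1, k + 1, P.mem_descendants_succ.2 ⟨z, hz, hk⟩, .inr ?_⟩
        rcases h3 with rfl | ⟨u, ⟨k', hk'⟩, hu, hus⟩
        · exact ⟨x₀, ⟨0, h0⟩, hz, hs⟩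
        · exact ⟨u, ⟨k' + 1, P.mem_descendants_succ.2 ⟨z, hz, hk'⟩⟩, hu, hus⟩

end TypedForest

section Geometry

open Set Filter MeasureTheory Metric Topology

/-! ### Similitudes of locally Euclidean spaces -/

/-- A point outside the closed range has distance at least `ε` from it, so its iterates are
`ε`-separated, which compactness forbids. -/
theorem Isometry.surjective_of_compactSpace {X : Type*} [MetricSpace X] [CompactSpace X] {f : X → X}
    (hf : Isometry f) : Function.Surjective f := by
  intro y
  by_contra hy
  have hcl : IsClosed (range f) := (isCompact_range hf.continuous).isClosed
  obtain ⟨ε, hε, hball⟩ := Metric.isOpen_iff.1 hcl.isOpen_compl y hy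
  have hdist : ∀ k m, k < m → ε ≤ dist (f^[k] y) (f^[m] y) := by
    intro k m hkm
    obtain ⟨l, rfl⟩ := Nat.exists_eq_add_of_lt hkm
    have h1 : ∀ k (a b : X), dist (f^[k] a) (f^[k] b) = dist a b := by
      intro k
      induction k with
      | zero => simp
      | succ k ih => intro a b; rw [Function.iterate_succ_apply, Function.iterate_succ_apply, ih,
          hf.dist_eq]
    rw [add_assoc, Function.iterate_add_apply, h1, Function.iterate_succ_apply']
    by_contra! hlt
    exact hball (by rwa [mem_ball, dist_comm]) ⟨_, rfl⟩
  obtain ⟨a, φ, hφ, hlim⟩ := CompactSpace.tendsto_subseq (fun k => f^[k] y)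
  obtain ⟨N, hN⟩ := Metric.cauchySeq_iff'.1 hlim.cauchySeq ε hε
  have h2 := hN (N + 1) N.le_succ
  rw [dist_comm] at h2
  exact absurd h2 (not_lt.2 (hdist _ _ (hφ N.lt_succ_self)))

section Similitude

variable {M : Type*} [MetricSpace M] {f : M → M} {ρ : ℝ}

theorem lipschitzWith_of_dist_eq (hf : ∀ x y, dist (f x) (f y) = ρ * dist x y) :
    LipschitzWith ρ.toNNReal f :=
  LipschitzWith.of_dist_le_mul fun x y => by
    rw [hf]
    exact mul_le_mul_of_nonneg_right (Real.le_coe_toNNReal ρ) dist_nonneg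

theorem antilipschitzWith_of_dist_eq (hρ : 0 < ρ) (hf : ∀ x y, dist (f x) (f y) = ρ * dist x y) :
    AntilipschitzWith (ρ⁻¹).toNNReal f :=
  AntilipschitzWith.of_le_mul_dist fun x y => by
    rw [hf, Real.coe_toNNReal _ (inv_nonneg.2 hρ.le), inv_mul_cancel_left₀ hρ.ne']

theorem isClosedEmbedding_of_dist_eq [CompleteSpace M] (hρ : 0 < ρ)
    (hf : ∀ x y, dist (f x) (f y) = ρ * dist x y) : IsClosedEmbedding f :=
  (antilipschitzWith_of_dist_eq hρ hf).isClosedEmbedding (lipschitzWith_of_dist_eq hf).uniformContinuous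

theorem isOpenMap_of_dist_eq [CompleteSpace M] (hρ : 0 < ρ)
    (hf : ∀ x y, dist (f x) (f y) = ρ * dist x y) (hsurj : Function.Surjective f) : IsOpenMap f :=
  (IsOpenEmbedding.mk (isClosedEmbedding_of_dist_eq hρ hf).isEmbedding
    (by rw [hsurj.range_eq]; exact isOpen_univ)).isOpenMap

/-- A similitude of a complete connected locally Euclidean space is onto. -/
theorem IsLocallyEuclidean.surjective_of_dist_eq {n : ℕ} [CompleteSpace M] [PreconnectedSpace M]
    [Nonempty M] (hM : IsLocallyEuclidean n M) (hρ : 0 < ρ)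
    (hf : ∀ x y, dist (f x) (f y) = ρ * dist x y) : Function.Surjective f := by
  have hclosed : IsClosed (range f) := (isClosedEmbedding_of_dist_eq hρ hf).isClosed_range
  -- In charts at `x` and `f x`, rescaled by `r` and `ρ * r`, `f` becomes an isometry of the closed
  -- unit ball into itself, hence onto. So the range contains the ball of radius `ρ * r` about `f
  -- x`.
  have hopen : IsOpen (range f) := by
    rw [Metric.isOpen_iff]
    rintro _ ⟨x, rfl⟩
    obtain ⟨U, -, hxU, φ, hφ, hφo⟩ := hM x
    obtain ⟨U', hU', hxU', φ', hφ', -⟩ := hM (f x)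
    obtain ⟨ε, hε, hε1⟩ := Metric.isOpen_iff.1 hφo _ ⟨⟨x, hxU⟩, rfl⟩
    obtain ⟨ε', hε', hε1'⟩ := Metric.isOpen_iff.1 hU' _ hxU'
    set r := min (ε / 2) (ε' / (2 * ρ)) with hr
    have hr0 : 0 < r := by positivity
    have hrε : r < ε := (min_le_left _ _).trans_lt (by linarith)
    have hrε' : ρ * r < ε' := by
      calc ρ * r ≤ ρ * (ε' / (2 * ρ)) := by gcongr; exact min_le_right _ _
        _ = ε' / 2 := by field_simp
        _ < ε' := by linarith
    have hρr : 0 < ρ * r := mul_pos hρ hr0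
    have hpre : ∀ v : closedBall (0 : EuclideanSpace ℝ (Fin n)) 1,
        ∃ y : U, φ y = φ ⟨x, hxU⟩ + r • (v : EuclideanSpace ℝ (Fin n)) := by
      intro v
      refine hε1 ?_
      rw [mem_ball, dist_eq_norm, add_sub_cancel_left, norm_smul, Real.norm_of_nonneg hr0.le]
      have hv : ‖(v : EuclideanSpace ℝ (Fin n))‖ ≤ 1 := mem_closedBall_zero_iff.1 v.2
      nlinarith
    choose y hy using hpre
    have hyy : ∀ v w, dist (y v : M) (y w) = r * dist v w := by
      intro v w
      have h1 : dist (y v : M) (y w) = dist (φ (y v)) (φ (y w)) := (hφ.dist_eq _ _).symm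
      rw [h1, hy, hy, dist_add_left, dist_smul₀, Real.norm_of_nonneg hr0.le, Subtype.dist_eq]
    have hyx : ∀ v, dist (y v : M) x = r * ‖(v : EuclideanSpace ℝ (Fin n))‖ := by
      intro v
      have h1 : dist (y v : M) x = dist (φ (y v)) (φ ⟨x, hxU⟩) := (hφ.dist_eq (y v) ⟨x, hxU⟩).symm
      rw [h1, hy, dist_eq_norm, add_sub_cancel_left, norm_smul, Real.norm_of_nonneg hr0.le]
    have hfy : ∀ v, f (y v) ∈ U' := by
      intro v
      refine hε1' ?_
      rw [mem_ball, hf, hyx]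
      have hv : ‖(v : EuclideanSpace ℝ (Fin n))‖ ≤ 1 := mem_closedBall_zero_iff.1 v.2
      calc ρ * (r * ‖(v : EuclideanSpace ℝ (Fin n))‖) ≤ ρ * (r * 1) := by gcongr
        _ < ε' := by rwa [mul_one]
    have hψmem : ∀ v, (ρ * r)⁻¹ • (φ' ⟨f (y v), hfy v⟩ - φ' ⟨f x, hxU'⟩) ∈
        closedBall (0 : EuclideanSpace ℝ (Fin n)) 1 := by
      intro v
      have hv : ‖(v : EuclideanSpace ℝ (Fin n))‖ ≤ 1 := mem_closedBall_zero_iff.1 v.2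
      rw [mem_closedBall_zero_iff, norm_smul, ← dist_eq_norm, hφ'.dist_eq, Subtype.dist_eq, hf, hyx,
        Real.norm_of_nonneg (inv_nonneg.2 hρr.le), ← mul_assoc ρ, inv_mul_cancel_left₀ hρr.ne']
      exact hv
    set ψ : closedBall (0 : EuclideanSpace ℝ (Fin n)) 1 →
      closedBall (0 : EuclideanSpace ℝ (Fin n)) 1 := fun v => ⟨_, hψmem v⟩ with hψ
    have hψi : Isometry ψ := by
      refine Isometry.of_dist_eq fun v w => ?_
      rw [Subtype.dist_eq]
      simp only [hψ]
      rw [dist_smul₀, dist_sub_right, hφ'.dist_eq, Subtype.dist_eq, hf, hyy,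
        Real.norm_of_nonneg (inv_nonneg.2 hρr.le), ← mul_assoc ρ, inv_mul_cancel_left₀ hρr.ne']
    have : CompactSpace (closedBall (0 : EuclideanSpace ℝ (Fin n)) 1) :=
      isCompact_iff_compactSpace.1 (isCompact_closedBall _ _)
    refine ⟨ρ * r, hρr, fun z hz => ?_⟩
    have hzU : z ∈ U' := hε1' ((mem_ball.1 hz).trans hrε')
    have hw : (ρ * r)⁻¹ • (φ' ⟨z, hzU⟩ - φ' ⟨f x, hxU'⟩) ∈
        closedBall (0 : EuclideanSpace ℝ (Fin n)) 1 := by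
      rw [mem_closedBall_zero_iff, norm_smul, ← dist_eq_norm, hφ'.dist_eq, Subtype.dist_eq,
        Real.norm_of_nonneg (inv_nonneg.2 hρr.le), inv_mul_le_iff₀ hρr, mul_one]
      exact (mem_ball.1 hz).le
    obtain ⟨v, hv⟩ := hψi.surjective_of_compactSpace ⟨_, hw⟩
    have h1 := congrArg Subtype.val hv
    simp only [hψ] at h1
    have h2 := smul_right_injective _ (inv_ne_zero hρr.ne') h1
    have h3 := hφ'.injective (sub_left_injective h2)
    exact ⟨y v, congrArg Subtype.val h3⟩
  have huniv := IsClopen.eq_univ ⟨hclosed, hopen⟩ (range_nonempty f)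
  exact range_eq_univ.1 huniv

end Similitude

/-- A Riemannian manifold with a finite distance is connected. -/
theorem preconnectedSpace_of_isRiemannianManifold (n : ℕ) (M : Type*) [MetricSpace M]
    [ChartedSpace (EuclideanSpace ℝ (Fin n)) M] [IsManifold (𝓡 n) ∞ M]
    [Bundle.RiemannianBundle (fun x : M => TangentSpace (𝓡 n) x)]
    [IsRiemannianManifold (𝓡 n) M] : PreconnectedSpace M := by
  refine ⟨isPreconnected_of_forall_pair fun x _ y _ => ?_⟩
  have h : Manifold.riemannianEDist (𝓡 n) x y < ⊤ := by
    rw [← IsRiemannianManifold.out (I := 𝓡 n) x y]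
    exact edist_lt_top x y
  obtain ⟨γ, h0, h1, hγ, -⟩ := Manifold.exists_lt_of_riemannianEDist_lt h
  refine ⟨γ '' Icc 0 1, subset_univ _, ⟨0, by simp, h0⟩, ⟨1, by simp, h1⟩, ?_⟩
  exact isPreconnected_Icc.image γ hγ.continuousOn

/-! ### Hausdorff measures -/

section Hausdorff

open Measure

theorem isAddHaarMeasure_hausdorffMeasure_euclideanSpace (n : ℕ) :
    IsAddHaarMeasure (μH[(n : ℝ)] : Measure (EuclideanSpace ℝ (Fin n))) := by
  have h := isAddHaarMeasure_hausdorffMeasure (E := EuclideanSpace ℝ (Fin n))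
  rwa [finrank_euclideanSpace_fin] at h

variable {M : Type*} [MetricSpace M] [MeasurableSpace M] [BorelSpace M]

theorem IsLocallyEuclidean.hausdorffMeasure_pos {n : ℕ} (hM : IsLocallyEuclidean n M) {O : Set M}
    (hO : IsOpen O) (hne : O.Nonempty) : 0 < μH[(n : ℝ)] O := by
  have := isAddHaarMeasure_hausdorffMeasure_euclideanSpace n
  obtain ⟨x, hx⟩ := hne
  obtain ⟨U, -, hxU, φ, hφ, hφo⟩ := hM x
  have hemb : IsOpenEmbedding φ := ⟨hφ.isEmbedding, hφo⟩
  set s : Set U := Subtype.val ⁻¹' O with hs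
  have h1 : 0 < μH[(n : ℝ)] (φ '' s) :=
    (hemb.isOpenMap _ (hO.preimage continuous_subtype_val)).measure_pos _ ⟨_, ⟨x, hxU⟩, hx, rfl⟩
  rw [hφ.hausdorffMeasure_image (.inl n.cast_nonneg),
    ← isometry_subtype_coe.hausdorffMeasure_image (.inl n.cast_nonneg)] at h1
  exact h1.trans_le (measure_mono (image_preimage_subset _ _))

/-- A Lebesgue number for the cover of `K` by charts puts all small balls centred in `K` inside
charts, where the Euclidean volume formula applies. -/
theorem IsLocallyEuclidean.exists_hausdorffMeasure_closedBall_le {n : ℕ}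
    (hM : IsLocallyEuclidean n M) {K : Set M} (hK : IsCompact K) :
    ∃ C : ENNReal, C ≠ ⊤ ∧ ∃ r₀ > 0, ∀ x ∈ K, ∀ r, 0 ≤ r → r < r₀ →
      μH[(n : ℝ)] (closedBall x r) ≤ ENNReal.ofReal (r ^ n) * C := by
  have := isAddHaarMeasure_hausdorffMeasure_euclideanSpace n
  choose U hU hxU φ hφ hφo using hM
  obtain ⟨δ, hδ, hδU⟩ := lebesgue_number_lemma_of_metric hK hU
    (fun x _ => mem_iUnion.2 ⟨x, hxU x⟩)
  refine ⟨μH[(n : ℝ)] (ball (0 : EuclideanSpace ℝ (Fin n)) 1), measure_ball_lt_top.ne, δ, hδ,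
    fun x hx r hr hrδ => ?_⟩
  obtain ⟨i, hi⟩ := hδU x hx
  have hsub : closedBall x r ⊆ U i := (closedBall_subset_ball hrδ).trans hi
  have hxi : x ∈ U i := hsub (mem_closedBall_self hr)
  set s : Set (U i) := Subtype.val ⁻¹' closedBall x r with hs
  have h1 : closedBall x r = Subtype.val '' s := by
    rw [hs, Subtype.image_preimage_coe, inter_eq_right.2 hsub]
  rw [h1, isometry_subtype_coe.hausdorffMeasure_image (.inl n.cast_nonneg),
    ← (hφ i).hausdorffMeasure_image (.inl n.cast_nonneg)]
  calc μH[(n : ℝ)] (φ i '' s) ≤ μH[(n : ℝ)] (closedBall (φ i ⟨x, hxi⟩) r) := by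
        refine measure_mono ?_
        rintro _ ⟨y, hy, rfl⟩
        rw [mem_closedBall, (hφ i).dist_eq]
        exact hy
    _ = _ := by rw [addHaar_closedBall _ _ hr, finrank_euclideanSpace_fin]

theorem le_hausdorffMeasure_image_of_dist_eq {f : M → M} {ρ : ℝ} (hρ : 0 < ρ)
    (hf : ∀ x y, dist (f x) (f y) = ρ * dist x y) (n : ℕ) (s : Set M) :
    ENNReal.ofReal (ρ ^ n) * μH[(n : ℝ)] s ≤ μH[(n : ℝ)] (f '' s) := by
  have h1 := (antilipschitzWith_of_dist_eq hρ hf).le_hausdorffMeasure_image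
    (d := (n : ℝ)) n.cast_nonneg s
  rw [ENNReal.rpow_natCast] at h1
  have h2 : ENNReal.ofReal (ρ ^ n) * (((ρ⁻¹).toNNReal : ENNReal)) ^ n = 1 := by
    change ENNReal.ofReal (ρ ^ n) * (ENNReal.ofReal ρ⁻¹) ^ n = 1
    rw [ENNReal.ofReal_pow hρ.le, ← mul_pow, ← ENNReal.ofReal_mul hρ.le, mul_inv_cancel₀ hρ.ne']
    simp
  calc _ ≤ ENNReal.ofReal (ρ ^ n) * ((((ρ⁻¹).toNNReal : ENNReal)) ^ n * μH[(n : ℝ)] (f '' s)) := by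
        gcongr
    _ = _ := by rw [← mul_assoc, h2, one_mul]

/-- Integrate the pointwise bound of the sum of the indicators by `N` times that of `B`. -/
theorem sum_measure_le_of_multiplicity {X ι : Type*} [MeasurableSpace X] (μ : Measure X)
    (Q : Finset ι) {A : ι → Set X} {B : Set X} (hA : ∀ i ∈ Q, MeasurableSet (A i))
    (hB : MeasurableSet B) (hAB : ∀ i ∈ Q, A i ⊆ B) (N : ℕ)
    (hN : ∀ x, ∀ R ⊆ Q, (∀ i ∈ R, x ∈ A i) → R.card ≤ N) :
    ∑ i ∈ Q, μ (A i) ≤ N * μ B := by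
  classical
  calc ∑ i ∈ Q, μ (A i) = ∑ i ∈ Q, ∫⁻ x, (A i).indicator 1 x ∂μ :=
        Finset.sum_congr rfl fun i hi => (lintegral_indicator_one (hA i hi)).symm
    _ = ∫⁻ x, ∑ i ∈ Q, (A i).indicator 1 x ∂μ :=
        (lintegral_finsetSum' _ fun i hi => (measurable_one.indicator (hA i hi)).aemeasurable).symm
    _ ≤ ∫⁻ x, N * B.indicator 1 x ∂μ := by
        refine lintegral_mono fun x => ?_
        by_cases hx : x ∈ B
        · rw [indicator_of_mem hx, Pi.one_apply, mul_one]
          have h1 : ∑ i ∈ Q, (A i).indicator (1 : X → ENNReal) x =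
              ((Q.filter fun i => x ∈ A i).card : ENNReal) := by
            simp [Set.indicator_apply]
          rw [h1]
          exact Nat.cast_le.2 (hN x _ (Finset.filter_subset _ _) fun i hi => (Finset.mem_filter.1 hi).2)
        · rw [Finset.sum_eq_zero]
          · exact zero_le
          · exact fun i hi => indicator_of_notMem (fun h => hx (hAB i hi h)) _
    _ = N * μ B := by
        rw [lintegral_const_mul _ (measurable_one.indicator hB), lintegral_indicator_one hB]

/-- A compact set has positive Hausdorff measure if the sums `∑ r ^ d` over its finite covers by
small balls of radii `r` are bounded away from zero. -/
theorem hausdorffMeasure_ne_zero_of_forall_cover [Nonempty M] {K : Set M} (hK : IsCompact K) {d r₀ δ : ℝ}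
    (hd : 0 < d) (hr₀ : 0 < r₀) (hδ : 0 < δ)
    (H : ∀ (L : Finset ℕ) (x : ℕ → M) (r : ℕ → ℝ), (∀ i ∈ L, x i ∈ K ∧ 0 < r i ∧ r i < r₀) →
      K ⊆ ⋃ i ∈ L, ball (x i) (r i) → δ ≤ ∑ i ∈ L, r i ^ d) : μH[d] K ≠ 0 := by
  intro h0
  rw [hausdorffMeasure_apply] at h0
  have h1 : (⨅ (t : ℕ → Set M) (_ : K ⊆ ⋃ n, t n)
      (_ : ∀ n, ediam (t n) ≤ ENNReal.ofReal (r₀ / 2)),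
        ∑' n, ⨆ _ : (t n).Nonempty, ediam (t n) ^ d) < ENNReal.ofReal (δ / 2) := by
    refine lt_of_le_of_lt ?_ (ENNReal.ofReal_pos.2 (half_pos hδ))
    rw [← h0]
    exact le_iSup₂_of_le (ENNReal.ofReal (r₀ / 2)) (ENNReal.ofReal_pos.2 (half_pos hr₀)) le_rfl
  simp only [iInf_lt_iff] at h1
  obtain ⟨t, htK, htd, hsum⟩ := h1
  obtain ⟨ε, hε, hεsum⟩ := ENNReal.exists_pos_sum_of_countable
    (ENNReal.ofReal_pos.2 (half_pos hδ)).ne' ℕ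
  -- Radii slightly larger than the diameters, so that open balls centred in the pieces cover them,
  -- even those of diameter zero; the excess `ε n` has total less than `δ / 2`.
  have hrad : ∀ n, ∃ r : ℝ, 0 < r ∧ r < r₀ ∧ ediam (t n) < ENNReal.ofReal r ∧
      ENNReal.ofReal (r ^ d) ≤ ediam (t n) ^ d + ε n := by
    intro n
    have hfin : ediam (t n) ≠ ⊤ := ne_top_of_le_ne_top ENNReal.ofReal_ne_top (htd n)
    set D := (ediam (t n)).toReal with hD
    have hD0 : 0 ≤ D := ENNReal.toReal_nonneg
    have hDe : ediam (t n) = ENNReal.ofReal D := (ENNReal.ofReal_toReal hfin).symm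
    have hDr : D < r₀ := by
      have h2 := htd n
      rw [hDe, ENNReal.ofReal_le_ofReal_iff (half_pos hr₀).le] at h2
      linarith
    have hlim : Tendsto (fun y : ℝ => y ^ d) (𝓝[>] D) (𝓝 (D ^ d)) :=
      ((Real.continuous_rpow_const hd.le).tendsto D).mono_left nhdsWithin_le_nhds
    have hlt : D ^ d < D ^ d + ε n := by
      have : (0 : ℝ) < ε n := hε n
      linarith
    obtain ⟨r, ⟨hr1, hr2⟩, hr3⟩ := ((hlim.eventually_lt_const hlt).and
      ((eventually_lt_nhds hDr).filter_mono nhdsWithin_le_nhds)).and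
        self_mem_nhdsWithin |>.exists
    have hr3' : D < r := hr3
    refine ⟨r, hD0.trans_lt hr3', hr2, ?_, ?_⟩
    · rw [hDe]
      exact (ENNReal.ofReal_lt_ofReal_iff (hD0.trans_lt hr3')).2 hr3'
    · rw [hDe, ENNReal.ofReal_rpow_of_nonneg hD0 hd.le, ← ENNReal.ofReal_coe_nnreal,
        ← ENNReal.ofReal_add (Real.rpow_nonneg hD0 _) (ε n).coe_nonneg]
      exact ENNReal.ofReal_le_ofReal hr1.le
  choose r hr0 hrr₀ hrd hrs using hrad
  set J : Set ℕ := {n | (t n ∩ K).Nonempty} with hJ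
  -- Only the pieces meeting `K` matter; for the others the centre is arbitrary.
  have hx : ∀ n, ∃ x, n ∈ J → x ∈ t n ∩ K := by
    intro n
    by_cases hn : n ∈ J
    · exact ⟨hn.some, fun _ => hn.some_mem⟩
    · exact ⟨Classical.arbitrary M, fun h => absurd h hn⟩
  choose x hx using hx
  have hcover : K ⊆ ⋃ n ∈ J, ball (x n) (r n) := by
    intro y hy
    obtain ⟨n, hn⟩ := mem_iUnion.1 (htK hy)
    have hnJ : n ∈ J := ⟨y, hn, hy⟩
    refine mem_iUnion₂.2 ⟨n, hnJ, ?_⟩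
    have h2 := (edist_le_ediam_of_mem hn (hx n hnJ).1).trans_lt (hrd n)
    rwa [edist_lt_ofReal] at h2
  obtain ⟨L, hLJ, hLfin, hLK⟩ := hK.elim_finite_subcover_image (fun n _ => isOpen_ball) hcover
  lift L to Finset ℕ using hLfin
  have h2 := H L x r (fun i hi => ⟨(hx i (hLJ hi)).2, hr0 i, hrr₀ i⟩) (by simpa using hLK)
  have h3 : ENNReal.ofReal (∑ i ∈ L, r i ^ d) < ENNReal.ofReal δ := by
    rw [ENNReal.ofReal_sum_of_nonneg fun i _ => Real.rpow_nonneg (hr0 i).le _]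
    calc ∑ i ∈ L, ENNReal.ofReal (r i ^ d) ≤ ∑ i ∈ L, (ediam (t i) ^ d + ε i) :=
          Finset.sum_le_sum fun i _ => hrs i
      _ = ∑ i ∈ L, ediam (t i) ^ d + ∑ i ∈ L, (ε i : ENNReal) := Finset.sum_add_distrib
      _ ≤ (∑' n, ⨆ _ : (t n).Nonempty, ediam (t n) ^ d) + ∑' i, (ε i : ENNReal) := by
          gcongr
          · refine le_trans (Finset.sum_le_sum fun i hi => ?_) (ENNReal.sum_le_tsum L)
            exact le_iSup_of_le ((hx i (hLJ hi)).imp_left id |>.1 |> fun h => ⟨_, h⟩) le_rfl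
          · exact ENNReal.sum_le_tsum L
      _ < ENNReal.ofReal (δ / 2) + ENNReal.ofReal (δ / 2) := ENNReal.add_lt_add hsum hεsum
      _ = ENNReal.ofReal δ := by
          rw [← ENNReal.ofReal_add (half_pos hδ).le (half_pos hδ).le, add_halves]
  exact absurd (ENNReal.ofReal_le_ofReal h2) (not_le.2 h3)

end Hausdorff

/-! ### Infinite chains -/

/-- Otherwise every element fails from some index on, and beyond the largest of these finitely many
indices nothing is left. -/
theorem Set.Finite.exists_forall_of_antitone {α : Type*} {S : Set α} (hS : S.Finite)
    {Q : ℕ → α → Prop} (hQ : ∀ k a, Q (k + 1) a → Q k a) (h : ∀ k, ∃ a ∈ S, Q k a) :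
    ∃ a ∈ S, ∀ k, Q k a := by
  by_contra! hcon
  have hQ' : ∀ a k l, k ≤ l → Q l a → Q k a := by
    intro a k l hkl
    induction l, hkl using Nat.le_induction with
    | base => exact id
    | succ l _ ih => exact fun hl => ih (hQ l a hl)
  choose! k hk using hcon
  obtain ⟨K, hK⟩ := (hS.image k).bddAbove
  obtain ⟨a, ha, haK⟩ := h K
  exact hk a ha (hQ' a _ _ (hK (mem_image_of_mem k ha)) haK)

/-- `a` starts a chain of length `k` through the sets `P m, …, P (m + k)`. -/
def HasChain {α : Type*} (P : ℕ → Set α) (R : α → α → Prop) : ℕ → ℕ → α → Prop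
  | 0, m, a => a ∈ P m
  | k + 1, m, a => a ∈ P m ∧ ∃ b, R a b ∧ HasChain P R k (m + 1) b

theorem HasChain.mem {α : Type*} {P : ℕ → Set α} {R : α → α → Prop} {k m : ℕ} {a : α}
    (h : HasChain P R k m a) : a ∈ P m := by
  cases k with
  | zero => exact h
  | succ k => exact h.1

theorem HasChain.pred {α : Type*} {P : ℕ → Set α} {R : α → α → Prop} {k m : ℕ} {a : α}
    (h : HasChain P R (k + 1) m a) : HasChain P R k m a := by
  induction k generalizing m a with
  | zero => exact h.1
  | succ k ih => exact ⟨h.1, h.2.imp fun b hb => ⟨hb.1, ih hb.2⟩⟩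

/-- **Kőnig's lemma**, for nonempty finite sets `P m` each element of which has a predecessor. -/
theorem exists_seq_of_forall_finite {α : Type*} {P : ℕ → Set α} (hfin : ∀ m, (P m).Finite)
    (hne : ∀ m, (P m).Nonempty) {R : α → α → Prop}
    (hR : ∀ m, ∀ b ∈ P (m + 1), ∃ a ∈ P m, R a b) :
    ∃ s : ℕ → α, (∀ m, s m ∈ P m) ∧ ∀ m, R (s m) (s (m + 1)) := by
  have h1 : ∀ k m, ∃ a ∈ P m, HasChain P R k m a := by
    intro k
    induction k with
    | zero => exact fun m => (hne m).imp fun a ha => ⟨ha, ha⟩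
    | succ k ih =>
      intro m
      obtain ⟨b, hb, hbk⟩ := ih (m + 1)
      obtain ⟨a, ha, hab⟩ := hR m b hb
      exact ⟨a, ha, ha, b, hab, hbk⟩
  obtain ⟨a₀, -, ha₀⟩ := (hfin 0).exists_forall_of_antitone (Q := fun k a => HasChain P R k 0 a)
    (fun k a h => h.pred) fun k => h1 k 0
  -- An element starting chains of every length has a successor doing the same, since the next set
  -- is finite.
  have h2 : ∀ m a, (∀ k, HasChain P R k m a) → ∃ b, R a b ∧ ∀ k, HasChain P R k (m + 1) b := by
    intro m a ha
    obtain ⟨b, -, hb⟩ := (hfin (m + 1)).exists_forall_of_antitone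
      (Q := fun k b => R a b ∧ HasChain P R k (m + 1) b) (fun k b h => ⟨h.1, h.2.pred⟩) fun k => by
        obtain ⟨-, b, hab, hb⟩ := ha (k + 1)
        exact ⟨b, hb.mem, hab, hb⟩
    exact ⟨b, (hb 0).1, fun k => (hb k).2⟩
  choose! next hnext using h2
  let s : ℕ → α := fun m => Nat.rec a₀ (fun m a => next m a) m
  have hs : ∀ m k, HasChain P R k m (s m) := by
    intro m
    induction m with
    | zero => exact ha₀
    | succ m ih => exact (hnext m (s m) ih).2
  exact ⟨s, fun m => hs m 0, fun m => (hnext m (s m) (hs m)).1⟩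

/-! ### Similarity ratios -/

/-- The ratio of a similitude. -/
noncomputable def similitudeRatio {M : Type*} [MetricSpace M] [Nontrivial M] (f : M → M) : ℝ :=
  dist (f (exists_pair_ne M).choose) (f (exists_pair_ne M).choose_spec.choose) /
    dist (exists_pair_ne M).choose (exists_pair_ne M).choose_spec.choose

/-- The ratio is read off the map, so it does not depend on the path representing a vertex. -/
theorem similitudeRatio_eq {M : Type*} [MetricSpace M] [Nontrivial M] {f : M → M} {c : ℝ}
    (hf : ∀ x y, dist (f x) (f y) = c * dist x y) : similitudeRatio f = c := by
  rw [similitudeRatio, hf, mul_div_cancel_right₀]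
  exact dist_ne_zero.2 (exists_pair_ne M).choose_spec.choose_spec

namespace SimilitudeGIFS

variable {V E M : Type*} [MetricSpace M] {G : SimilitudeGIFS V E M}

/-! ### Paths -/

theorem pathMap_append (p w : List E) : G.pathMap (p ++ w) = G.pathMap p ∘ G.pathMap w := by
  induction p with
  | nil => rfl
  | cons e p ih => simp only [List.cons_append, pathMap, ih, Function.comp_assoc]

theorem pathRatio_append (p w : List E) :
    G.pathRatio (p ++ w) = G.pathRatio p * G.pathRatio w := by
  simp [pathRatio]

theorem pathRatio_pos (p : List E) : 0 < G.pathRatio p := by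
  refine List.prod_pos fun x hx => ?_
  obtain ⟨e, -, rfl⟩ := List.mem_map.1 hx
  exact G.ratio_pos e

theorem dist_pathMap (p : List E) (x y : M) :
    dist (G.pathMap p x) (G.pathMap p y) = G.pathRatio p * dist x y := by
  induction p with
  | nil => simp [pathMap, pathRatio]
  | cons e p ih =>
    simp only [pathMap, Function.comp_apply, G.dist_map, ih]
    simp [pathRatio, mul_assoc]

theorem isPath_append {i j : V} {p w : List E} :
    G.IsPath i (p ++ w) j ↔ ∃ k, G.IsPath i p k ∧ G.IsPath k w j := by
  induction p generalizing i with
  | nil => simp [IsPath]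
  | cons e p ih => simp [IsPath, ih, and_assoc]

theorem IsPath.right_unique {i j j' : V} {p : List E} (h : G.IsPath i p j) (h' : G.IsPath i p j') :
    j = j' := by
  induction p generalizing i with
  | nil => exact h.symm.trans h'
  | cons e p ih => exact ih h.2 h'.2

theorem IsPath.left_unique {i i' j : V} {p : List E} (h : G.IsPath i p j) (h' : G.IsPath i' p j) :
    i = i' := by
  cases p with
  | nil => exact Eq.trans h (Eq.symm h')
  | cons e p => exact h.1.symm.trans h'.1

theorem pathMap_surjective (hG : ∀ e, Function.Surjective (G.map e)) (p : List E) :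
    Function.Surjective (G.pathMap p) := by
  induction p with
  | nil => exact Function.surjective_id
  | cons e p ih => exact (hG e).comp ih

theorem IsPath.image_subset {A : V → Set M} (hA : ∀ e, G.map e '' A (G.tgt e) ⊆ A (G.src e))
    {i j : V} {p : List E} (h : G.IsPath i p j) : G.pathMap p '' A j ⊆ A i := by
  induction p generalizing i with
  | nil =>
    obtain rfl : i = j := h
    simp [pathMap]
  | cons e p ih =>
    rw [pathMap, image_comp]
    rw [← h.1]
    exact (image_mono (ih h.2)).trans (hA e)

theorem exists_ratio_le [Finite E] (G : SimilitudeGIFS V E M) :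
    ∃ c : ℝ, 0 < c ∧ c < 1 ∧ ∀ e, G.ratio e ≤ c := by
  rcases isEmpty_or_nonempty E with h | h
  · exact ⟨1 / 2, by norm_num, by norm_num, fun e => isEmptyElim e⟩
  · obtain ⟨e, he⟩ := Finite.exists_max G.ratio
    exact ⟨G.ratio e, G.ratio_pos e, G.ratio_lt_one e, he⟩

theorem pathRatio_le_pow {c : ℝ} (hc : ∀ e, G.ratio e ≤ c) (p : List E) :
    G.pathRatio p ≤ c ^ p.length := by
  induction p with
  | nil => simp [pathRatio]
  | cons e p ih =>
    have h1 : G.pathRatio (e :: p) = G.ratio e * G.pathRatio p := by simp [pathRatio]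
    rw [h1, List.length_cons, pow_succ']
    exact mul_le_mul (hc e) ih (pathRatio_pos p).le ((G.ratio_pos e).le.trans (hc e))

theorem minLength_le_length {A : Finset (List E)} {p : List E} (hp : p ∈ A) :
    minLength A ≤ p.length :=
  Nat.sInf_le ⟨p, hp, rfl⟩

/-! ### Vertices of all levels -/

section Vertices

variable {F : ℕ → Finset (List E)} {ν σ : LevelVertex V M} {p w : List E}

theorem Represents.dist_map (h : G.Represents F p ν) (x y : M) :
    dist (ν.map x) (ν.map y) = G.pathRatio p * dist x y := by
  rw [← h.2.1, dist_pathMap]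

theorem Represents.similitudeRatio_eq [Nontrivial M] (h : G.Represents F p ν) :
    similitudeRatio ν.map = G.pathRatio p :=
  _root_.similitudeRatio_eq h.dist_map

theorem similitudeRatio_pos [Nontrivial M] (h : ν ∈ G.vertices F) : 0 < similitudeRatio ν.map := by
  obtain ⟨p, hp⟩ := h
  rw [hp.similitudeRatio_eq]
  exact pathRatio_pos p

theorem dist_map_of_mem_vertices [Nontrivial M] (h : ν ∈ G.vertices F) (x y : M) :
    dist (ν.map x) (ν.map y) = similitudeRatio ν.map * dist x y := by
  obtain ⟨p, hp⟩ := h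
  rw [hp.similitudeRatio_eq, hp.dist_map]

theorem surjective_of_mem_vertices (hG : ∀ e, Function.Surjective (G.map e))
    (h : ν ∈ G.vertices F) : Function.Surjective ν.map := by
  obtain ⟨p, hp⟩ := h
  rw [← hp.2.1]
  exact pathMap_surjective hG p

theorem finite_vertices_level [Finite V] (G : SimilitudeGIFS V E M) (F : ℕ → Finset (List E))
    (k : ℕ) : {ν | ν ∈ G.vertices F ∧ ν.level = k}.Finite := by
  have h1 : (Set.range fun x : V × V × (insert [] (F k : Set (List E)) : Set (List E)) =>
      (⟨G.pathMap x.2.2, x.1, x.2.1, k⟩ : LevelVertex V M)).Finite := by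
    have : Finite (insert [] (F k : Set (List E)) : Set (List E)) :=
      ((F k).finite_toSet.insert []).to_subtype
    exact Set.finite_range _
  refine h1.subset ?_
  rintro ν ⟨⟨p, hp1, hp2, hp3⟩, rfl⟩
  refine ⟨⟨ν.init, ν.term, p, ?_⟩, ?_⟩
  · rcases hp3 with ⟨-, rfl⟩ | ⟨-, hp3⟩
    · exact Set.mem_insert _ _
    · exact Set.mem_insert_of_mem _ hp3
  · ext1
    · exact hp2
    all_goals rfl

theorem root_represents (G : SimilitudeGIFS V E M) (F : ℕ → Finset (List E)) (i : V) :
    G.Represents F [] ⟨id, i, i, 0⟩ :=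
  ⟨rfl, rfl, .inl ⟨rfl, rfl⟩⟩

theorem eq_root (h : ν ∈ G.vertices F) (hl : ν.level = 0) : ν = ⟨id, ν.init, ν.init, 0⟩ := by
  obtain ⟨p, hp1, hp2, ⟨-, rfl⟩ | ⟨hp3, -⟩⟩ := h
  · ext1
    · exact hp2.symm
    · rfl
    · exact Eq.symm hp1
    · exact hl
  · omega

theorem Edge.mem_left (h : G.Edge F ν w σ) : ν ∈ G.vertices F :=
  let ⟨p, hp, _⟩ := h.2.2
  ⟨p, hp⟩

theorem Edge.mem_right (h : G.Edge F ν w σ) : σ ∈ G.vertices F :=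
  let ⟨p, _, hp⟩ := h.2.2
  ⟨p ++ w, hp⟩

theorem Edge.map_eq (h : G.Edge F ν w σ) : σ.map = ν.map ∘ G.pathMap w := by
  obtain ⟨p, hp, hpw⟩ := h.2.2
  rw [← hp.2.1, ← hpw.2.1, pathMap_append]

theorem Edge.isPath (h : G.Edge F ν w σ) : G.IsPath ν.term w σ.term := by
  obtain ⟨p, hp, hpw⟩ := h.2.2
  obtain ⟨k, hk, hkw⟩ := isPath_append.1 hpw.1
  rw [h.2.1] at hk
  rwa [hp.1.right_unique hk]

theorem Edge.similitudeRatio_eq [Nontrivial M] (h : G.Edge F ν w σ) :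
    similitudeRatio σ.map = similitudeRatio ν.map * G.pathRatio w := by
  obtain ⟨p, hp, hpw⟩ := h.2.2
  rw [hp.similitudeRatio_eq, hpw.similitudeRatio_eq, pathRatio_append]

theorem Edge.image_subset {A : V → Set M} (hA : ∀ e, G.map e '' A (G.tgt e) ⊆ A (G.src e))
    (h : G.Edge F ν w σ) : σ.map '' A σ.term ⊆ ν.map '' A ν.term := by
  rw [h.map_eq, image_comp]
  exact image_mono (h.isPath.image_subset hA)

theorem exists_edge (hF : G.IsNested F) {k : ℕ} (hσ : σ ∈ G.vertices F) (hl : σ.level = k + 1) :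
    ∃ ν w, G.Edge F ν w σ := by
  obtain ⟨v, hv⟩ := hσ
  obtain ⟨hv1, hv2, ⟨h0, -⟩ | ⟨-, hv3⟩⟩ := id hv
  · omega
  rcases Nat.eq_zero_or_pos k with rfl | hk
  · exact ⟨⟨id, σ.init, σ.init, 0⟩, v, hl, rfl, [], G.root_represents F σ.init, hv⟩
  · rw [hl] at hv3
    obtain ⟨u, hu, w, rfl⟩ := hF.exists_prefix k hk v (hF.subset_paths (k + 1) (by omega) hv3)
      (.inr hv3)
    obtain ⟨j, hj, -⟩ := isPath_append.1 hv1
    exact ⟨⟨G.pathMap u, σ.init, j, k⟩, w, hl, rfl, u, ⟨hj, rfl, .inr ⟨hk, hu⟩⟩, hv⟩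

theorem IsAttractor.exists_path {K : V → Set M} (hK : G.IsAttractor K) (m : ℕ) {i : V} {x : M}
    (hx : x ∈ K i) : ∃ p j, G.IsPath i p j ∧ p.length = m ∧ x ∈ G.pathMap p '' K j := by
  induction m generalizing i x with
  | zero => exact ⟨[], i, rfl, rfl, x, hx, rfl⟩
  | succ m ih =>
    rw [hK.2.2 i] at hx
    obtain ⟨e, rfl, y, hy, rfl⟩ := mem_iUnion₂.1 hx
    obtain ⟨p, j, hp, hpm, z, hz, rfl⟩ := ih hy
    exact ⟨e :: p, j, ⟨rfl, hp⟩, by simp [hpm], z, hz, rfl⟩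

theorem IsAttractor.image_subset {K : V → Set M} (hK : G.IsAttractor K) (e : E) :
    G.map e '' K (G.tgt e) ⊆ K (G.src e) := by
  rw [hK.2.2 (G.src e)]
  exact subset_iUnion₂_of_subset e rfl subset_rfl

variable [LinearOrder E]

theorem MinEdge.label_unique {ν' : LevelVertex V M} {w' : List E} (h : G.MinEdge F ν w σ)
    (h' : G.MinEdge F ν' w' σ) : w = w' :=
  le_antisymm (h.2 _ _ h'.1) (h'.2 _ _ h.1)

/-- Both edges carry the same label `w`, and the surjective map `S_w` can be cancelled on the right.
This is what makes the reduced graph a forest. -/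
theorem MinEdge.source_unique (hG : ∀ e, Function.Surjective (G.map e)) {ν' : LevelVertex V M}
    {w' : List E} (h : G.MinEdge F ν w σ) (h' : G.MinEdge F ν' w' σ) : ν = ν' := by
  obtain rfl := h.label_unique h'
  ext1
  · have h1 : ν.map ∘ G.pathMap w = ν'.map ∘ G.pathMap w := by rw [← h.1.map_eq, ← h'.1.map_eq]
    exact (pathMap_surjective hG w).injective_comp_right h1
  · rw [← h.1.2.1, ← h'.1.2.1]
  · exact h.1.isPath.left_unique h'.1.isPath
  · have h1 := h.1.1
    have h2 := h'.1.1
    omega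

theorem exists_minEdge (hF : G.IsNested F) {k : ℕ} (hσ : σ ∈ G.vertices F)
    (hl : σ.level = k + 1) : ∃ ν w, G.MinEdge F ν w σ := by
  set L : Set (List E) := {w | ∃ ν, G.Edge F ν w σ} with hL
  -- Labels of incoming edges are suffixes of paths in the finite set `F (k + 1)`.
  have hfin : L.Finite := by
    refine ((F (k + 1)).finite_toSet.biUnion fun v _ => (List.finite_toSet v.tails)).subset ?_
    rintro w ⟨ν, -, -, p, -, -, -, h⟩
    rcases h with ⟨h, -⟩ | ⟨-, h⟩
    · omega
    · rw [hl] at h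
      exact mem_iUnion₂.2 ⟨p ++ w, h, (List.mem_tails _ _).2 (List.suffix_append p w)⟩
  obtain ⟨ν, w, h⟩ := exists_edge hF hσ hl
  obtain ⟨w₀, ⟨ν₀, h₀⟩, hmin⟩ := Set.exists_min_image L id hfin ⟨w, ν, h⟩
  exact ⟨ν₀, w₀, h₀, fun ν' w' h' => hmin w' ⟨ν', h'⟩⟩

theorem finite_minEdge [Finite V] (ν : LevelVertex V M) : {σ | ∃ w, G.MinEdge F ν w σ}.Finite :=
  (G.finite_vertices_level F (ν.level + 1)).subset fun _ ⟨_, h⟩ => ⟨h.1.mem_right, h.1.1⟩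

/-! ### Coverings by vertices of the reduced graph -/

/-- Every point of `K i` lies in the cells of an infinite path of the reduced graph starting
from the root. -/
theorem IsAttractor.exists_chain [Finite V] {K : V → Set M} (hK : G.IsAttractor K)
    (hF : G.IsNested F) {i : V} {x : M} (hx : x ∈ K i) :
    ∃ s : ℕ → LevelVertex V M, s 0 = ⟨id, i, i, 0⟩ ∧
      (∀ m, ∃ w, G.MinEdge F (s m) w (s (m + 1))) ∧ ∀ m, x ∈ (s m).map '' K (s m).term := by
  -- Kőnig's lemma is applied to the vertices of level `m` whose cell contains `x`: minimal edges
  -- lead backwards, and cells grow in that direction.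
  set P : ℕ → Set (LevelVertex V M) := fun m =>
    {ν | ν ∈ G.vertices F ∧ ν.level = m ∧ ν.init = i ∧ x ∈ ν.map '' K ν.term} with hP
  have hfin : ∀ m, (P m).Finite := fun m =>
    (G.finite_vertices_level F m).subset fun ν h => ⟨h.1, h.2.1⟩
  have hne : ∀ m, (P m).Nonempty := by
    intro m
    rcases Nat.eq_zero_or_pos m with rfl | hm
    · exact ⟨⟨id, i, i, 0⟩, ⟨[], G.root_represents F i⟩, rfl, rfl, x, hx, rfl⟩
    -- Only paths strictly longer than `maxLength` are certain to have a prefix in `F m`.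
    · obtain ⟨v, j, hv, hvl, hxv⟩ := hK.exists_path (maxLength (F m) + 1) hx
      have hv0 : v ≠ [] := by
        rintro rfl
        simp at hvl
      obtain ⟨u, hu, w, rfl⟩ := hF.exists_prefix m hm v ⟨hv0, i, j, hv⟩ (.inl (by omega))
      obtain ⟨k, hk, hkw⟩ := isPath_append.1 hv
      refine ⟨⟨G.pathMap u, i, k, m⟩, ⟨u, hk, rfl, .inr ⟨hm, hu⟩⟩, rfl, rfl, ?_⟩
      rw [pathMap_append, image_comp] at hxv
      exact image_mono (hkw.image_subset hK.image_subset) hxv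
  obtain ⟨s, hs, hsR⟩ := exists_seq_of_forall_finite hfin hne
    (R := fun ν σ => ∃ w, G.MinEdge F ν w σ) (by
      rintro m σ ⟨hσ, hl, hi, hxσ⟩
      obtain ⟨ν, w, h⟩ := exists_minEdge hF hσ hl
      have h1 := h.1.1
      exact ⟨ν, ⟨h.1.mem_left, by omega, h.1.2.1 ▸ hi, h.1.image_subset hK.image_subset hxσ⟩, w, h⟩)
  refine ⟨s, ?_, hsR, fun m => (hs m).2.2.2⟩
  have h1 := eq_root (hs 0).1 (hs 0).2.1
  rwa [(hs 0).2.2.1] at h1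

theorem mem_reducedVertices_of_chain {s : ℕ → LevelVertex V M}
    (hs : ∀ m, ∃ w, G.MinEdge F (s m) w (s (m + 1))) (m : ℕ) : s m ∈ G.reducedVertices F := by
  obtain ⟨w, hw⟩ := hs m
  exact ⟨hw.1.mem_left, fun l => s (m + l), rfl, fun l => hs (m + l)⟩

end Vertices

/-! ### Neighbourhoods -/

theorem Equivalent.ncard_eq {F : ℕ → Finset (List E)} {Ω : V → Set M} {ν ν' : LevelVertex V M}
    (h : G.Equivalent F Ω ν ν') : (G.nbhd F Ω ν).ncard = (G.nbhd F Ω ν').ncard := by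
  obtain ⟨-, τ, -, hb, -⟩ := h
  rw [← hb.image_eq, hb.injOn.ncard_image]

/-- As `S_ν` is onto, `τ` is a similitude with ratio `ρ_ν' / ρ_ν`, so sizes of neighbours relative
to the centre depend only on the type. -/
theorem Equivalent.similitudeRatio_le [Nontrivial M] {F : ℕ → Finset (List E)} {Ω : V → Set M}
    {ν ν' : LevelVertex V M} (h : G.Equivalent F Ω ν ν')
    (hG : ∀ e, Function.Surjective (G.map e)) (hν : ν ∈ G.vertices F) (hν' : ν' ∈ G.vertices F)
    {C : ℝ} (hC : ∀ σ ∈ G.nbhd F Ω ν, similitudeRatio σ.map ≤ C * similitudeRatio ν.map) :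
    ∀ σ ∈ G.nbhd F Ω ν', similitudeRatio σ.map ≤ C * similitudeRatio ν'.map := by
  obtain ⟨-, τ, hτ, hb, -⟩ := h
  intro σ' hσ'
  obtain ⟨σ, hσ, rfl⟩ := hb.surjOn hσ'
  have hν0 := similitudeRatio_pos hν
  have hν0' := similitudeRatio_pos hν'
  have h1 : ∀ y z, dist (τ y) (τ z) =
      similitudeRatio ν'.map / similitudeRatio ν.map * dist y z := by
    intro y z
    obtain ⟨a, rfl⟩ := surjective_of_mem_vertices hG hν y
    obtain ⟨b, rfl⟩ := surjective_of_mem_vertices hG hν z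
    have h2 : ∀ c, τ (ν.map c) = ν'.map c := fun c => congrFun hτ c
    rw [h2, h2, dist_map_of_mem_vertices hν', dist_map_of_mem_vertices hν]
    field_simp
  have h3 : similitudeRatio (transfer τ ν' σ).map =
      similitudeRatio ν'.map / similitudeRatio ν.map * similitudeRatio σ.map := by
    refine similitudeRatio_eq fun y z => ?_
    simp only [transfer, Function.comp_apply, h1, dist_map_of_mem_vertices hσ.1]
    ring
  rw [h3]
  calc _ ≤ similitudeRatio ν'.map / similitudeRatio ν.map * (C * similitudeRatio ν.map) := by
        gcongr
        exact hC σ hσ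
    _ = _ := by field_simp

theorem finite_nbhd [Finite V] (G : SimilitudeGIFS V E M) (F : ℕ → Finset (List E))
    (Ω : V → Set M) (ν : LevelVertex V M) : (G.nbhd F Ω ν).Finite :=
  (G.finite_vertices_level F ν.level).subset fun _ h => ⟨h.1, h.2.1⟩

theorem exists_nbhd_bound [Finite V] [Nontrivial M] {F : ℕ → Finset (List E)} {Ω : V → Set M}
    (hG : ∀ e, Function.Surjective (G.map e)) [Finite (G.NbhdType F Ω (G.vertices F))] :
    ∃ (N : ℕ) (C : ℝ), 0 < C ∧ ∀ ν ∈ G.vertices F, (G.nbhd F Ω ν).ncard ≤ N ∧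
      ∀ σ ∈ G.nbhd F Ω ν, similitudeRatio σ.map ≤ C * similitudeRatio ν.map := by
  have hbound : ∀ ν : G.vertices F, ∃ C : ℝ,
      ∀ σ ∈ G.nbhd F Ω ν, similitudeRatio σ.map ≤ C * similitudeRatio ν.1.map := by
    intro ν
    obtain ⟨B, hB⟩ := ((G.finite_nbhd F Ω ν).image fun σ =>
      similitudeRatio σ.map / similitudeRatio ν.1.map).bddAbove
    refine ⟨B, fun σ hσ => ?_⟩
    rw [← div_le_iff₀ (similitudeRatio_pos ν.2)]
    exact hB (mem_image_of_mem _ hσ)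
  choose C hC using hbound
  obtain ⟨N, hN⟩ := (Set.finite_range fun t : G.NbhdType F Ω (G.vertices F) =>
    (G.nbhd F Ω t.out).ncard).bddAbove
  obtain ⟨C', hC'⟩ := (Set.finite_range fun t : G.NbhdType F Ω (G.vertices F) =>
    C t.out).bddAbove
  refine ⟨N, max C' 1, by positivity, fun ν hν => ?_⟩
  set t : G.NbhdType F Ω (G.vertices F) := G.typeOf F Ω ⟨ν, hν⟩ with ht
  have heq : G.Equivalent F Ω t.out ν := Quotient.exact (t.out_eq)
  refine ⟨heq.ncard_eq ▸ hN ⟨t, rfl⟩, fun σ hσ => ?_⟩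
  refine (heq.similitudeRatio_le hG t.out.2 hν (hC t.out) σ hσ).trans ?_
  have h1 : C t.out ≤ max C' 1 := (hC' ⟨t, rfl⟩).trans (le_max_left _ _)
  have := (similitudeRatio_pos hν).le
  gcongr

/-! ### The reduced graph as a forest -/

section Forest

variable [LinearOrder E] {F : ℕ → Finset (List E)} {Ω : V → Set M}

theorem exists_minEdge_of_mem_reducedVertices (ν : G.reducedVertices F) :
    ∃ σ : G.reducedVertices F, ∃ w, G.MinEdge F ν w σ := by
  obtain ⟨ν, -, s, rfl, hs⟩ := ν
  exact ⟨⟨s 1, mem_reducedVertices_of_chain hs 1⟩, hs 0⟩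

theorem finite_minEdge_reducedVertices [Finite V] (ν : G.reducedVertices F) :
    {σ : G.reducedVertices F | ∃ w, G.MinEdge F ν w σ}.Finite :=
  (finite_minEdge ν.1).preimage (f := Subtype.val) Subtype.val_injective.injOn

/-- A child determines its label, so the sum over labelled edges is a sum over children, and `ρ_w`
is the quotient of the two sizes. -/
theorem offspringWeight_eq_sum [Finite V] [Nontrivial M] (β : ℝ) (ν : G.reducedVertices F)
    (t : G.NbhdType F Ω (G.reducedVertices F)) (S : Finset (G.reducedVertices F))
    (hS : ∀ σ, σ ∈ S ↔ (∃ w, G.MinEdge F ν w σ) ∧ G.typeOf F Ω σ = t) :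
    G.offspringWeight F Ω β ν t =
      ∑ σ ∈ S, (similitudeRatio σ.1.map / similitudeRatio ν.1.map) ^ β := by
  have hf : Function.Bijective (fun x : {x : List E × G.reducedVertices F //
      G.MinEdge F ν x.1 x.2 ∧ G.typeOf F Ω x.2 = t} =>
        (⟨x.1.2, (hS _).2 ⟨⟨x.1.1, x.2.1⟩, x.2.2⟩⟩ : S)) := by
    constructor
    · rintro ⟨⟨w, σ⟩, h, h'⟩ ⟨⟨w', σ'⟩, k, k'⟩ heq
      obtain rfl : σ = σ' := congrArg Subtype.val heq
      obtain rfl : w = w' := h.label_unique k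
      rfl
    · rintro ⟨σ, hσ⟩
      obtain ⟨⟨w, hw⟩, hσt⟩ := (hS σ).1 hσ
      exact ⟨⟨⟨w, σ⟩, hw, hσt⟩, rfl⟩
  rw [offspringWeight, finsum_eq_of_bijective _ hf
    (g := fun σ : S => (similitudeRatio σ.1.1.map / similitudeRatio ν.1.map) ^ β),
    finsum_eq_sum_of_fintype, Finset.sum_coe_sort S
    (fun σ => (similitudeRatio σ.1.map / similitudeRatio ν.1.map) ^ β)]
  rintro ⟨⟨w, σ⟩, h, -⟩
  have := (similitudeRatio_pos h.1.mem_left).ne'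
  simp only
  rw [h.1.similitudeRatio_eq, mul_div_cancel_left₀ _ this]

theorem exists_forest [Finite V] [Finite E] [Nontrivial M] (hF : G.IsNested F)
    (hG : ∀ e, Function.Surjective (G.map e)) {q : ℕ}
    (T : Fin q ≃ G.NbhdType F Ω (G.reducedVertices F)) (A : ℝ → Matrix (Fin q) (Fin q) ℝ)
    (hA : ∀ β : ℝ, G.IsWeightedIncidenceMatrix F Ω T β (A β)) :
    ∃ P : TypedForest (G.reducedVertices F) q,
      (∀ ν σ, σ ∈ P.children ν ↔ ∃ w, G.MinEdge F ν w σ) ∧ (∀ ν, P.level ν = ν.1.level) ∧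
      (∀ ν, P.ratio ν = similitudeRatio ν.1.map) ∧ P.mat = A := by
  classical
  obtain ⟨c, hc0, hc1, hc⟩ := G.exists_ratio_le
  refine ⟨{
    children := fun ν => (finite_minEdge_reducedVertices ν).toFinset
    level := fun ν => ν.1.level
    type := fun ν => T.symm (G.typeOf F Ω ν)
    ratio := fun ν => similitudeRatio ν.1.map
    mat := A
    gap := c
    gap_pos := hc0
    gap_lt_one := hc1
    ratio_pos := fun ν => similitudeRatio_pos ν.2.1
    children_nonempty := fun ν => ?_
    level_child := fun ν σ h => ?_
    parent_unique := fun ν ν' σ h h' => ?_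
    type_surjective := fun i => ?_
    mat_apply := fun β ν j => ?_
    ratio_child := fun ν σ h => ?_
    tendsto_ratio := fun s hs => ?_ }, ?_, fun _ => rfl, fun _ => rfl, rfl⟩
  · obtain ⟨σ, hσ⟩ := exists_minEdge_of_mem_reducedVertices ν
    exact ⟨σ, by simpa using hσ⟩
  · obtain ⟨w, hw⟩ := (Finite.mem_toFinset _).1 h
    exact hw.1.1
  · obtain ⟨w, hw⟩ := (Finite.mem_toFinset _).1 h
    obtain ⟨w', hw'⟩ := (Finite.mem_toFinset _).1 h'
    exact Subtype.ext (hw.source_unique hG hw')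
  · obtain ⟨ν, hν⟩ := Quotient.exists_rep (T i)
    exact ⟨ν, (Equiv.symm_apply_eq T).2 hν⟩
  · rw [hA β (T.symm (G.typeOf F Ω ν)) j ν (by simp)]
    refine offspringWeight_eq_sum β ν (T j) _ fun σ => ?_
    simp [Equiv.symm_apply_eq]
  · obtain ⟨w, hw⟩ := (Finite.mem_toFinset _).1 h
    have h1 := hw.1.similitudeRatio_eq
    -- An empty label keeps the size; a nonempty one contracts at least by the largest edge ratio.
    rcases List.eq_nil_or_concat w with rfl | ⟨w', e, rfl⟩
    · left
      simpa [pathRatio] using h1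
    · right
      have h2 := pathRatio_le_pow hc (w' ++ [e])
      have h3 : c ^ (w' ++ [e]).length ≤ c := by
        rw [List.length_append, List.length_singleton, pow_succ]
        exact mul_le_of_le_one_left hc0.le (pow_le_one₀ hc0.le hc1.le)
      rw [h1, mul_comm]
      exact mul_le_mul_of_nonneg_right (by simpa using h2.trans h3) (similitudeRatio_pos ν.2.1).le
  · have hlevel : ∀ m, (s m).1.level = (s 0).1.level + m := by
      intro m
      induction m with
      | zero => rfl
      | succ m ih =>
        obtain ⟨w, hw⟩ := (Finite.mem_toFinset _).1 (hs m)
        rw [hw.1.1, ih, add_assoc]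
    have hlim : Tendsto (fun m => c ^ minLength (F ((s 0).1.level + m))) atTop (𝓝 0) :=
      (tendsto_pow_atTop_nhds_zero_of_lt_one hc0.le hc1).comp
        (hF.tendsto_minLength.comp (tendsto_atTop_mono (fun m => Nat.le_add_left m _) tendsto_id))
    refine squeeze_zero' (Eventually.of_forall fun m => (similitudeRatio_pos (s m).2.1).le) ?_ hlim
    filter_upwards [eventually_ge_atTop 1] with m hm
    obtain ⟨p, hp⟩ := (s m).2.1
    rw [hp.similitudeRatio_eq]
    rcases hp.2.2 with ⟨h0, -⟩ | ⟨-, hpF⟩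
    · rw [hlevel] at h0
      omega
    · rw [hlevel] at hpF
      exact (pathRatio_le_pow hc p).trans
        (pow_le_pow_of_le_one hc0.le hc1.le (minLength_le_length hpF))
  · intro ν σ
    simp

end Forest

/-! ### Dimension bounds for the attractor -/

section Dimension

variable [LinearOrder E] {F : ℕ → Finset (List E)} {Ω : V → Set M} {q : ℕ}
  {P : TypedForest (G.reducedVertices F) q}

theorem init_eq_of_mem_descendants (hP : ∀ ν σ, σ ∈ P.children ν ↔ ∃ w, G.MinEdge F ν w σ) {k : ℕ}
    {ν σ : G.reducedVertices F} (h : σ ∈ P.descendants k ν) : σ.1.init = ν.1.init := by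
  induction k generalizing ν with
  | zero => rw [P.mem_descendants_zero.1 h]
  | succ k ih =>
    obtain ⟨η, hη, hσ⟩ := P.mem_descendants_succ.1 h
    obtain ⟨w, hw⟩ := (hP _ _).1 hη
    rw [ih hσ, hw.1.2.1]

theorem image_subset_of_mem_descendants
    (hP : ∀ ν σ, σ ∈ P.children ν ↔ ∃ w, G.MinEdge F ν w σ) {A : V → Set M}
    (hA : ∀ e, G.map e '' A (G.tgt e) ⊆ A (G.src e)) {k : ℕ} {ν σ : G.reducedVertices F}
    (h : σ ∈ P.descendants k ν) : σ.1.map '' A σ.1.term ⊆ ν.1.map '' A ν.1.term := by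
  induction k generalizing ν with
  | zero => rw [P.mem_descendants_zero.1 h]
  | succ k ih =>
    obtain ⟨η, hη, hσ⟩ := P.mem_descendants_succ.1 h
    obtain ⟨w, hw⟩ := (hP _ _).1 hη
    exact (ih hσ).trans (hw.1.image_subset hA)

/-- An upper bound for the dimension of the attractor. -/
theorem IsAttractor.dimH_le [Finite V] [Nontrivial M] {K : V → Set M} (hK : G.IsAttractor K)
    (hF : G.IsNested F) (hP : ∀ ν σ, σ ∈ P.children ν ↔ ∃ w, G.MinEdge F ν w σ)
    (hPr : ∀ ν, P.ratio ν = similitudeRatio ν.1.map) {β : ℝ} (hβ : 0 ≤ β)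
    (hr : (P.mat β).realSpectralRadius < 1) (i : V) : dimH (K i) ≤ ENNReal.ofReal β := by
  borelize M
  obtain ⟨D, hD0, hD⟩ : ∃ D : ℝ, 0 < D ∧ ∀ j, diam (K j) ≤ D := by
    obtain ⟨D, hD⟩ := (Set.finite_range fun j => diam (K j)).bddAbove
    exact ⟨max D 1, by positivity, fun j => (hD ⟨j, rfl⟩).trans (le_max_left _ _)⟩
  obtain ⟨x₀, hx₀⟩ := hK.1 i
  obtain ⟨s, hs0, hs, -⟩ := hK.exists_chain hF hx₀
  set ν₀ : G.reducedVertices F := ⟨⟨id, i, i, 0⟩, hs0 ▸ mem_reducedVertices_of_chain hs 0⟩ with hν₀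
  have hdiam : ∀ σ : G.reducedVertices F,
      ediam (σ.1.map '' K σ.1.term) ≤ ENNReal.ofReal (D * P.ratio σ) := by
    intro σ
    refine ediam_le ?_
    rintro _ ⟨a, ha, rfl⟩ _ ⟨b, hb, rfl⟩
    rw [edist_dist]
    refine ENNReal.ofReal_le_ofReal ?_
    rw [dist_map_of_mem_vertices σ.2.1, hPr, mul_comm]
    exact mul_le_mul_of_nonneg_right ((dist_le_diam_of_mem (hK.2.1 _).isBounded ha hb).trans (hD _))
      (similitudeRatio_pos σ.2.1).le
  have hb := P.one_lt_base
  have hb0 : 0 < P.base := one_pos.trans hb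
  have hlim : Tendsto (fun k : ℕ => ENNReal.ofReal
      (D * (P.base ^ q * P.ratio ν₀ * (P.base⁻¹) ^ k))) atTop (𝓝 0) := by
    have h1 := (((tendsto_pow_atTop_nhds_zero_of_lt_one (inv_nonneg.2 hb0.le)
      (inv_lt_one_of_one_lt₀ hb)).const_mul (P.base ^ q * P.ratio ν₀)).const_mul D)
    simpa using ENNReal.tendsto_ofReal h1
  -- Cover by the cells of the `k`-th generation below the root: their diameters tend to zero
  -- uniformly, and eventually the row sums of `mat β ^ k` are at most `1`.
  have hμ : μH[β] (K i) ≤ ENNReal.ofReal (D ^ β * P.ratio ν₀ ^ β) := by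
    refine (Measure.hausdorffMeasure_le_liminf_sum (ι := fun k => P.descendants k ν₀) β (K i) _ hlim
      (fun k σ => σ.1.1.map '' K σ.1.1.term) (Eventually.of_forall fun k σ => ?_)
      (Eventually.of_forall fun k x hx => ?_)).trans ?_
    · refine (hdiam σ.1).trans (ENNReal.ofReal_le_ofReal ?_)
      have h1 := P.ratio_descendant_le σ.2
      rw [inv_pow, ← div_eq_mul_inv]
      gcongr
      rw [le_div_iff₀ (pow_pos hb0 k)]
      linarith
    · obtain ⟨s, hs0, hs, hsx⟩ := hK.exists_chain hF hx
      have hmem : ∀ m (h : s m ∈ G.reducedVertices F),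
          (⟨s m, h⟩ : G.reducedVertices F) ∈ P.descendants m ν₀ := by
        intro m
        induction m with
        | zero => exact fun h => P.mem_descendants_zero.2 (Subtype.ext hs0)
        | succ m ih =>
          exact fun h => P.mem_descendants_succ'.2
            ⟨_, ih (mem_reducedVertices_of_chain hs m), (hP _ _).2 (hs m)⟩
      exact mem_iUnion.2 ⟨⟨_, hmem k (mem_reducedVertices_of_chain hs k)⟩, hsx k⟩
    · refine liminf_le_of_frequently_le' (Eventually.frequently ?_)
      filter_upwards [Matrix.eventually_sum_pow_le_one hr] with k hk
      calc ∑ σ : P.descendants k ν₀, ediam (σ.1.1.map '' K σ.1.1.term) ^ β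
          ≤ ∑ σ : P.descendants k ν₀, ENNReal.ofReal (D ^ β * P.ratio σ.1 ^ β) := by
            refine Finset.sum_le_sum fun σ _ => ?_
            rw [← Real.mul_rpow hD0.le (P.ratio_pos _).le, ← ENNReal.ofReal_rpow_of_nonneg
              (mul_nonneg hD0.le (P.ratio_pos _).le) hβ]
            exact ENNReal.rpow_le_rpow (hdiam σ.1) hβ
        _ = ENNReal.ofReal (D ^ β * ∑ σ ∈ P.descendants k ν₀, P.ratio σ ^ β) := by
            rw [Finset.mul_sum, ENNReal.ofReal_sum_of_nonneg, Finset.sum_coe_sort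
              (P.descendants k ν₀) (fun σ => ENNReal.ofReal (D ^ β * P.ratio σ ^ β))]
            exact fun σ _ => mul_nonneg (Real.rpow_nonneg hD0.le _)
              (Real.rpow_nonneg (P.ratio_pos _).le _)
        _ ≤ _ := by
            refine ENNReal.ofReal_le_ofReal (mul_le_mul_of_nonneg_left ?_
              (Real.rpow_nonneg hD0.le _))
            exact (P.sum_descendants_le β k ν₀).trans
              (mul_le_of_le_one_right (Real.rpow_nonneg (P.ratio_pos _).le _) (hk _))
  have h2 : μH[((β.toNNReal : NNReal) : ℝ)] (K i) ≠ ⊤ := by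
    rw [Real.coe_toNNReal β hβ]
    exact ne_top_of_le_ne_top ENNReal.ofReal_ne_top hμ
  exact dimH_le_of_hausdorffMeasure_ne_top h2

/-- Descendants of a vertex with sizes comparable to `r` overlap a bounded number of times. -/
theorem exists_multiplicity_bound [Finite V] [Nontrivial M]
    (hG : ∀ e, Function.Surjective (G.map e)) [Finite (G.NbhdType F Ω (G.vertices F))]
    (hΩ : ∀ e, G.map e '' Ω (G.tgt e) ⊆ Ω (G.src e))
    (hP : ∀ ν σ, σ ∈ P.children ν ↔ ∃ w, G.MinEdge F ν w σ)
    (hPl : ∀ ν, P.level ν = ν.1.level)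
    (hPr : ∀ ν, P.ratio ν = similitudeRatio ν.1.map) {κ : ℝ} (hκ : 0 < κ)
    (ν₀ : G.reducedVertices F) :
    ∃ N : ℕ, ∀ (r : ℝ) (y : M) (R : Finset (G.reducedVertices F)), 0 < r →
      (∀ σ ∈ R, (∃ k, σ ∈ P.descendants k ν₀) ∧ κ * r ≤ P.ratio σ ∧ P.ratio σ ≤ r ∧
        y ∈ σ.1.map '' Ω σ.1.term) → R.card ≤ N := by
  classical
  obtain ⟨N, C, hC, hNC⟩ := exists_nbhd_bound (G := G) (F := F) (Ω := Ω) hG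
  obtain ⟨B, -, hB⟩ := P.exists_card_le
  have hb := P.one_lt_base
  obtain ⟨g₀, hg₀⟩ := pow_unbounded_of_one_lt (P.base ^ q * C / κ) hb
  refine ⟨N * ∑ g ∈ Finset.range g₀, B ^ g, fun r y R hr hR => ?_⟩
  rcases R.eq_empty_or_nonempty with rfl | hne
  · simp
  -- Take `σ₀` of lowest level. The ancestor at that level of any other `σ` also contains `y` in its
  -- open cell, so it is one of at most `N` neighbours of `σ₀`.
  obtain ⟨σ₀, hσ₀, hmin⟩ := R.exists_min_image P.level hne
  obtain ⟨⟨k₀, hk₀⟩, -, hσ₀r, hσ₀y⟩ := hR σ₀ hσ₀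
  have hfin : (Subtype.val ⁻¹' G.nbhd F Ω σ₀.1 : Set (G.reducedVertices F)).Finite :=
    (G.finite_nbhd F Ω σ₀.1).preimage Subtype.val_injective.injOn
  have hcard : hfin.toFinset.card ≤ N := by
    rw [← Set.ncard_eq_toFinset_card _ hfin]
    refine le_trans ?_ (hNC σ₀.1 σ₀.2.1).1
    exact Set.ncard_le_ncard_of_injOn Subtype.val (fun _ h => h) Subtype.val_injective.injOn
      (G.finite_nbhd F Ω σ₀.1)
  have hsub : R ⊆ hfin.toFinset.biUnion fun τ =>
      (Finset.range g₀).biUnion fun g => P.descendants g τ := by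
    intro σ hσ
    obtain ⟨⟨k, hk⟩, hσκ, hσr, hσy⟩ := hR σ hσ
    have hk₀k : k₀ ≤ k := by
      have h1 := hmin σ hσ
      rw [P.level_descendant hk, P.level_descendant hk₀] at h1
      omega
    obtain ⟨g, rfl⟩ := Nat.exists_eq_add_of_le hk₀k
    obtain ⟨τ, hτ, hστ⟩ := P.mem_descendants_add.1 hk
    have hτn : τ.1 ∈ G.nbhd F Ω σ₀.1 := by
      refine ⟨τ.2.1, ?_, ?_, y, hσ₀y, image_subset_of_mem_descendants hP hΩ hστ hσy⟩
      · rw [← hPl, ← hPl, P.level_descendant hτ, P.level_descendant hk₀]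
      · rw [init_eq_of_mem_descendants hP hτ, init_eq_of_mem_descendants hP hk₀]
    refine Finset.mem_biUnion.2 ⟨τ, hfin.mem_toFinset.2 hτn, Finset.mem_biUnion.2 ⟨g, ?_, hστ⟩⟩
    rw [Finset.mem_range]
    -- The ancestor has size at most `C * r`, so after `g₀` generations its descendants would be
    -- smaller than `κ * r`.
    by_contra! hcon
    have h1 := (hNC σ₀.1 σ₀.2.1).2 τ.1 hτn
    rw [← hPr, ← hPr] at h1
    have h2 := P.ratio_descendant_le hστ
    have hb0 : 0 < P.base := one_pos.trans hb
    have h3 : P.base ^ g * (κ * r) ≤ P.base ^ q * (C * r) := by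
      calc P.base ^ g * (κ * r) ≤ P.base ^ g * P.ratio σ := by gcongr
        _ ≤ _ := h2
        _ ≤ P.base ^ q * (C * P.ratio σ₀) := by gcongr
        _ ≤ _ := by gcongr
    have h4 : P.base ^ g ≤ P.base ^ q * C / κ := by
      rw [le_div_iff₀ hκ]
      refine le_of_mul_le_mul_right ?_ hr
      linarith
    have h5 := pow_le_pow_right₀ hb.le hcon
    linarith
  calc R.card ≤ _ := Finset.card_le_card hsub
    _ ≤ hfin.toFinset.card * ∑ g ∈ Finset.range g₀, B ^ g := by
        refine Finset.card_biUnion_le_card_mul _ _ _ fun τ _ => ?_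
        exact Finset.card_biUnion_le.trans
          (Finset.sum_le_sum fun g _ => P.card_descendants_le hB g τ)
    _ ≤ _ := Nat.mul_le_mul_right _ hcard

/-- Near a point of the attractor there are boundedly many cells of size comparable to `r`. -/
theorem exists_card_bound [Finite V] [Nontrivial M] [CompleteSpace M] {n : ℕ}
    (hM : IsLocallyEuclidean n M) (hG : ∀ e, Function.Surjective (G.map e))
    [Finite (G.NbhdType F Ω (G.vertices F))] (hΩ : G.IsInvariantFamily Ω)
    {K : V → Set M} (hK : G.IsAttractor K)
    (hP : ∀ ν σ, σ ∈ P.children ν ↔ ∃ w, G.MinEdge F ν w σ)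
    (hPl : ∀ ν, P.level ν = ν.1.level)
    (hPr : ∀ ν, P.ratio ν = similitudeRatio ν.1.map) {κ : ℝ} (hκ : 0 < κ)
    (ν₀ : G.reducedVertices F) {X : Set M} (hX : IsCompact X) :
    ∃ W : ℝ, 0 ≤ W ∧ ∃ r₀ > 0, ∀ x ∈ X, ∀ r, 0 < r → r < r₀ → ∀ Q : Finset (G.reducedVertices F),
      (∀ σ ∈ Q, (∃ k, σ ∈ P.descendants k ν₀) ∧ κ * r ≤ P.ratio σ ∧ P.ratio σ ≤ r ∧
        (σ.1.map '' K σ.1.term ∩ ball x r).Nonempty) → (Q.card : ℝ) ≤ W := by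
  borelize M
  obtain ⟨N, hN⟩ := exists_multiplicity_bound hG hΩ.2 hP hPl hPr hκ ν₀
  obtain ⟨C, hC, r₁, hr₁, hvol⟩ := hM.exists_hausdorffMeasure_closedBall_le hX
  obtain ⟨D, hD0, hD⟩ : ∃ D : ℝ, 0 < D ∧ ∀ j, ∀ a ∈ K j, ∀ b ∈ Ω j, dist b a ≤ D := by
    obtain ⟨D, hD⟩ := (Set.finite_range fun j => diam (K j ∪ Ω j)).bddAbove
    refine ⟨max D 1, by positivity, fun j a ha b hb => ?_⟩
    exact (dist_le_diam_of_mem ((hK.2.1 j).isBounded.union (hΩ.1 j).2.1) (.inr hb) (.inl ha)).trans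
      ((hD ⟨j, rfl⟩).trans (le_max_left _ _))
  obtain ⟨a, ha0, hatop, ha⟩ : ∃ a : ENNReal, a ≠ 0 ∧ a ≠ ⊤ ∧ ∀ j, a ≤ μH[(n : ℝ)] (Ω j) := by
    have : Nonempty V := ⟨ν₀.1.init⟩
    obtain ⟨j, hj⟩ := Finite.exists_min fun j => μH[(n : ℝ)] (Ω j)
    -- The minimum with `1` keeps the lower volume bound finite.
    refine ⟨min (μH[(n : ℝ)] (Ω j)) 1, ?_, by simp, fun k => (min_le_left _ _).trans (hj k)⟩
    exact (lt_min (hM.hausdorffMeasure_pos (hΩ.1 j).2.2 (hΩ.1 j).1) one_pos).ne'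
  -- Multiplicity times the volume bound for a ball of radius `(1 + D) * r`, which contains all the
  -- open cells, divided by the least volume of one cell; the factor `r ^ n` cancels.
  set W : ENNReal := N * (ENNReal.ofReal ((1 + D) ^ n) * C) / (ENNReal.ofReal (κ ^ n) * a) with hW
  have hden : ENNReal.ofReal (κ ^ n) * a ≠ 0 :=
    mul_ne_zero (ENNReal.ofReal_pos.2 (pow_pos hκ n)).ne' ha0
  have hden' : ENNReal.ofReal (κ ^ n) * a ≠ ⊤ := ENNReal.mul_ne_top ENNReal.ofReal_ne_top hatop
  have hWtop : W ≠ ⊤ := ENNReal.div_ne_top (ENNReal.mul_ne_top (ENNReal.natCast_ne_top N)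
    (ENNReal.mul_ne_top ENNReal.ofReal_ne_top hC)) hden
  refine ⟨W.toReal, ENNReal.toReal_nonneg, r₁ / (1 + D), by positivity,
    fun x hx r hr hrr Q hQ => ?_⟩
  have hrr' : (1 + D) * r < r₁ := by rwa [lt_div_iff₀' (by positivity)] at hrr
  have hsub : ∀ σ ∈ Q, σ.1.map '' Ω σ.1.term ⊆ closedBall x ((1 + D) * r) := by
    rintro σ hσ _ ⟨b, hb, rfl⟩
    obtain ⟨-, -, hσr, _, ⟨c, hc, rfl⟩, hcx⟩ := hQ σ hσ
    have h1 : dist (σ.1.map b) (σ.1.map c) ≤ r * D := by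
      rw [dist_map_of_mem_vertices σ.2.1, ← hPr]
      exact mul_le_mul hσr (hD _ c hc b hb) dist_nonneg hr.le
    have h2 := dist_triangle (σ.1.map b) (σ.1.map c) x
    have h3 := mem_ball.1 hcx
    rw [mem_closedBall]
    linarith
  have hmeas : ∀ σ ∈ Q, MeasurableSet (σ.1.map '' Ω σ.1.term) := fun σ _ =>
    (isOpenMap_of_dist_eq (similitudeRatio_pos σ.2.1) (dist_map_of_mem_vertices σ.2.1)
      (surjective_of_mem_vertices hG σ.2.1) _ (hΩ.1 _).2.2).measurableSet
  have hlow : ∀ σ ∈ Q, ENNReal.ofReal (r ^ n) * (ENNReal.ofReal (κ ^ n) * a) ≤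
      μH[(n : ℝ)] (σ.1.map '' Ω σ.1.term) := by
    intro σ hσ
    obtain ⟨-, hσκ, -, -⟩ := hQ σ hσ
    refine le_trans ?_ (le_hausdorffMeasure_image_of_dist_eq (similitudeRatio_pos σ.2.1)
      (dist_map_of_mem_vertices σ.2.1) n _)
    rw [← mul_assoc, ← ENNReal.ofReal_mul (pow_nonneg hr.le n), ← mul_pow, ← hPr]
    gcongr
    · linarith
    · exact ha _
  have hsum := sum_measure_le_of_multiplicity μH[(n : ℝ)] Q hmeas
    (isClosed_closedBall (x := x) (ε := (1 + D) * r)).measurableSet hsub N fun y R hR hyR =>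
      hN r y R hr fun σ hσ =>
        ⟨(hQ σ (hR hσ)).1, (hQ σ (hR hσ)).2.1, (hQ σ (hR hσ)).2.2.1, hyR σ hσ⟩
  have h1 : ENNReal.ofReal (r ^ n) * ((Q.card : ENNReal) * (ENNReal.ofReal (κ ^ n) * a)) ≤
      ENNReal.ofReal (r ^ n) * (N * (ENNReal.ofReal ((1 + D) ^ n) * C)) := by
    calc _ = ∑ σ ∈ Q, ENNReal.ofReal (r ^ n) * (ENNReal.ofReal (κ ^ n) * a) := by
          rw [Finset.sum_const, nsmul_eq_mul]
          ring
      _ ≤ _ := Finset.sum_le_sum hlow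
      _ ≤ _ := hsum
      _ ≤ N * (ENNReal.ofReal (((1 + D) * r) ^ n) * C) := by
          gcongr
          exact hvol x hx _ (by positivity) hrr'
      _ = _ := by
          rw [mul_pow, ENNReal.ofReal_mul (by positivity)]
          ring
  have h2 : (Q.card : ENNReal) * (ENNReal.ofReal (κ ^ n) * a) ≤
      N * (ENNReal.ofReal ((1 + D) ^ n) * C) :=
    (ENNReal.mul_le_mul_iff_right (ENNReal.ofReal_pos.2 (pow_pos hr n)).ne'
      ENNReal.ofReal_ne_top).1 h1
  have h3 : (Q.card : ENNReal) ≤ W := (ENNReal.le_div_iff_mul_le (.inl hden) (.inl hden')).2 h2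
  have h4 := ENNReal.toReal_mono hWtop h3
  rwa [ENNReal.toReal_natCast] at h4

/-- A lower bound for the dimension of the attractor. -/
theorem IsAttractor.exists_le_dimH [Finite V] [Nontrivial M] [CompleteSpace M] {n : ℕ}
    (hM : IsLocallyEuclidean n M) (hG : ∀ e, Function.Surjective (G.map e))
    [Finite (G.NbhdType F Ω (G.vertices F))] (hΩ : G.IsInvariantFamily Ω)
    {K : V → Set M} (hK : G.IsAttractor K)
    (hP : ∀ ν σ, σ ∈ P.children ν ↔ ∃ w, G.MinEdge F ν w σ)
    (hPl : ∀ ν, P.level ν = ν.1.level)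
    (hPr : ∀ ν, P.ratio ν = similitudeRatio ν.1.map) {α : ℝ} (hα : 0 < α) (hsub : P.Sub α 1) :
    ∃ i, ENNReal.ofReal α ≤ dimH (K i) := by
  classical
  borelize M
  obtain ⟨h, h0, hne, hle⟩ := hsub
  obtain ⟨i₀, hi₀⟩ : ∃ i, h i ≠ 0 := by
    by_contra! hcon
    exact hne (funext hcon)
  have hi₀' : 0 < h i₀ := (h0 i₀).lt_of_ne hi₀.symm
  obtain ⟨ν₀, hν₀⟩ := P.type_surjective i₀
  obtain ⟨κ, hκ, hκ1, hκP⟩ := P.exists_le_ratio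
  set X : Set M := ν₀.1.map '' K ν₀.1.term with hX
  have hcont : Continuous ν₀.1.map :=
    (lipschitzWith_of_dist_eq (dist_map_of_mem_vertices ν₀.2.1)).continuous
  have hXc : IsCompact X := (hK.2.1 _).image hcont
  have hXne : X.Nonempty := (hK.1 _).image _
  obtain ⟨W, hW0, r₁, hr₁, hW⟩ := exists_card_bound hM hG hΩ hK hP hPl hPr hκ ν₀ hXc
  obtain ⟨H, hH⟩ := (Set.finite_range h).bddAbove
  have hH0 : 0 ≤ H := hi₀'.le.trans (hH ⟨i₀, rfl⟩)
  set m : G.reducedVertices F → ℝ := fun σ => P.ratio σ ^ α * h (P.type σ) with hm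
  have hm0 : ∀ σ, 0 ≤ m σ := fun σ => mul_nonneg (Real.rpow_nonneg (P.ratio_pos σ).le _) (h0 _)
  have hmchild : ∀ σ, m σ ≤ ∑ τ ∈ P.children σ, m τ := by
    intro σ
    have h1 := hle (P.type σ)
    rw [one_mul, P.sum_children] at h1
    have h2 := mul_le_mul_of_nonneg_left h1 (Real.rpow_nonneg (P.ratio_pos σ).le α)
    refine h2.trans (le_of_eq ?_)
    rw [Finset.mul_sum]
    refine Finset.sum_congr rfl fun τ _ => ?_
    have := (Real.rpow_pos_of_pos (P.ratio_pos σ) α).ne'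
    rw [Real.div_rpow (P.ratio_pos τ).le (P.ratio_pos σ).le]
    simp only [hm]
    field_simp
  have hmν₀ : 0 < m ν₀ := mul_pos (Real.rpow_pos_of_pos (P.ratio_pos ν₀) _) (hν₀ ▸ hi₀')
  have hμ : μH[α] X ≠ 0 := by
    have : Nonempty M := ⟨hXne.some⟩
    -- Radii below `P.ratio ν₀` ensure that the tree is not cut at `ν₀` itself. The `+ 1` keeps the
    -- denominator positive if `W * H = 0`.
    refine hausdorffMeasure_ne_zero_of_forall_cover hXc hα (lt_min hr₁ (P.ratio_pos ν₀))
      (div_pos hmν₀ (by positivity : 0 < W * H + 1)) fun L x r hL hXL => ?_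
    set cutAt : G.reducedVertices F → Prop := fun σ =>
      ∃ l ∈ L, (σ.1.map '' K σ.1.term ∩ ball (x l) (r l)).Nonempty ∧ P.ratio σ ≤ r l with hcut
    have hb := P.one_lt_base
    have hb0 : 0 < P.base := one_pos.trans hb
    obtain ⟨N, hN⟩ : ∃ N : ℕ, ∀ l ∈ L, P.base ^ q * P.ratio ν₀ * (P.base⁻¹) ^ N < r l := by
      have hlim : Tendsto (fun k : ℕ => P.base ^ q * P.ratio ν₀ * (P.base⁻¹) ^ k) atTop (𝓝 0) := by
        simpa using (tendsto_pow_atTop_nhds_zero_of_lt_one (inv_nonneg.2 hb0.le)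
          (inv_lt_one_of_one_lt₀ hb)).const_mul (P.base ^ q * P.ratio ν₀)
      exact ((Filter.eventually_all_finset L).2 fun l hl =>
        hlim.eventually_lt_const (hL l hl).2.1).exists
    have hdX : ∀ k, ∀ σ ∈ P.descendants k ν₀, σ.1.map '' K σ.1.term ⊆ X := fun k σ hσ =>
      image_subset_of_mem_descendants hP hK.image_subset hσ
    obtain ⟨C, hCm, hC⟩ := P.exists_cut hmchild cutAt N ν₀ (by
      intro σ hσ
      obtain ⟨z, hz⟩ := (hK.1 σ.1.term).image σ.1.map
      obtain ⟨l, hl, hzl⟩ := mem_iUnion₂.1 (hXL (hdX N σ hσ hz))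
      refine ⟨l, hl, ⟨z, hz, hzl⟩, le_trans ?_ (hN l hl).le⟩
      rw [inv_pow, ← div_eq_mul_inv, le_div_iff₀ (pow_pos hb0 N), mul_comm]
      exact P.ratio_descendant_le hσ)
    set Q : ℕ → Finset (G.reducedVertices F) := fun l => C.filter fun σ =>
      κ * r l ≤ P.ratio σ ∧ P.ratio σ ≤ r l ∧
        (σ.1.map '' K σ.1.term ∩ ball (x l) (r l)).Nonempty with hQ
    have hCQ : ∀ σ ∈ C, ∃ l ∈ L, σ ∈ Q l := by
      intro σ hσ
      obtain ⟨⟨l, hl, hhit, hσr⟩, k, hk, hor⟩ := hC σ hσ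
      refine ⟨l, hl, Finset.mem_filter.2 ⟨hσ, ?_, hσr, hhit⟩⟩
      -- The cell of the parent `η` contains that of `σ` and meets the same ball, yet `η` was not
      -- cut: so `η` is larger than `r l`, and `σ` is at least `κ * r l`.
      rcases hor with rfl | ⟨η, -, hησ, hη⟩
      · exact absurd ((hL l hl).2.2.trans_le (min_le_right _ _)) (not_lt.2 hσr)
      · have hηr : r l < P.ratio η := by
          by_contra! hcon
          obtain ⟨w, hw⟩ := (hP _ _).1 hησ
          exact hη ⟨l, hl, hhit.mono (inter_subset_inter_left _
            (hw.1.image_subset hK.image_subset)), hcon⟩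
        exact (mul_le_mul_of_nonneg_left hηr.le hκ.le).trans (hκP η σ hησ)
    have hQcard : ∀ l ∈ L, ((Q l).card : ℝ) ≤ W := by
      intro l hl
      refine hW (x l) (hL l hl).1 (r l) (hL l hl).2.1 ((hL l hl).2.2.trans_le (min_le_left _ _))
        (Q l) fun σ hσ => ?_
      obtain ⟨hσC, h1, h2, h3⟩ := Finset.mem_filter.1 hσ
      obtain ⟨-, k, hk, -⟩ := hC σ hσC
      exact ⟨⟨k, hk⟩, h1, h2, h3⟩
    have hQsum : ∀ l ∈ L, ∑ σ ∈ Q l, m σ ≤ W * H * r l ^ α := by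
      intro l hl
      have hrl := (hL l hl).2.1
      calc ∑ σ ∈ Q l, m σ ≤ ∑ σ ∈ Q l, r l ^ α * H := by
            refine Finset.sum_le_sum fun σ hσ => ?_
            obtain ⟨-, -, h2, -⟩ := Finset.mem_filter.1 hσ
            exact mul_le_mul (Real.rpow_le_rpow (P.ratio_pos σ).le h2 hα.le) (hH ⟨_, rfl⟩) (h0 _)
              (Real.rpow_nonneg hrl.le _)
        _ = (Q l).card * (r l ^ α * H) := by rw [Finset.sum_const, nsmul_eq_mul]
        _ ≤ W * (r l ^ α * H) := by
            gcongr
            exact hQcard l hl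
        _ = _ := by ring
    rw [div_le_iff₀' (by positivity)]
    calc m ν₀ ≤ ∑ σ ∈ C, m σ := hCm
      -- Every cut vertex is charged to at least one ball, and the order of summation is exchanged.
      _ ≤ ∑ σ ∈ C, ∑ l ∈ L, if σ ∈ Q l then m σ else 0 := by
          refine Finset.sum_le_sum fun σ hσ => ?_
          obtain ⟨l, hl, hσl⟩ := hCQ σ hσ
          calc m σ = if σ ∈ Q l then m σ else 0 := by rw [if_pos hσl]
            _ ≤ _ := Finset.single_le_sum (f := fun l => if σ ∈ Q l then m σ else 0)
                (fun l _ => by split_ifs <;> [exact hm0 σ; exact le_rfl]) hl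
      _ = ∑ l ∈ L, ∑ σ ∈ Q l, m σ := by
          rw [Finset.sum_comm]
          refine Finset.sum_congr rfl fun l _ => ?_
          rw [← Finset.sum_filter]
          refine Finset.sum_congr ?_ fun _ _ => rfl
          ext σ
          simp only [hQ, Finset.mem_filter]
          tauto
      _ ≤ ∑ l ∈ L, W * H * r l ^ α := Finset.sum_le_sum hQsum
      _ = W * H * ∑ l ∈ L, r l ^ α := by rw [Finset.mul_sum]
      _ ≤ (W * H + 1) * ∑ l ∈ L, r l ^ α := by
          refine mul_le_mul_of_nonneg_right (by linarith) ?_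
          exact Finset.sum_nonneg fun l hl => Real.rpow_nonneg (hL l hl).2.1.le _
  have hXK : X ⊆ K ν₀.1.init := by
    obtain ⟨p, hp1, hp2, -⟩ := ν₀.2.1
    rw [hX, ← hp2]
    exact hp1.image_subset hK.image_subset
  refine ⟨ν₀.1.init, le_trans ?_ (dimH_mono hXK)⟩
  have h2 : μH[((α.toNNReal : NNReal) : ℝ)] X ≠ 0 := by rwa [Real.coe_toNNReal α hα.le]
  exact le_dimH_of_hausdorffMeasure_ne_zero h2

end Dimension

end SimilitudeGIFS

theorem IsLocallyEuclidean.nontrivial {n : ℕ} (hn : 1 ≤ n) {M : Type*} [MetricSpace M] [Nonempty M]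
    (hM : IsLocallyEuclidean n M) : Nontrivial M := by
  obtain ⟨U, -, hxU, φ, -, hφo⟩ := hM (Classical.arbitrary M)
  have : Nontrivial (EuclideanSpace ℝ (Fin n)) := by
    have : Nonempty (Fin n) := ⟨⟨0, hn⟩⟩
    infer_instance
  obtain ⟨-, ⟨a, rfl⟩, hne⟩ := (infinite_of_mem_nhds _ (hφo.mem_nhds ⟨⟨_, hxU⟩, rfl⟩)).nontrivial.exists_ne
    (φ ⟨_, hxU⟩)
  exact ⟨a, _, fun h => hne (congrArg φ (Subtype.ext h))⟩

end Geometry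

/-! ### The dimension formula -/

theorem theorem1p6 (n : ℕ) (hn : 1 ≤ n)
    {M : Type*} [MetricSpace M] [CompleteSpace M]
    [ChartedSpace (EuclideanSpace ℝ (Fin n)) M] [IsManifold (𝓡 n) ∞ M]
    [Bundle.RiemannianBundle (fun x : M => TangentSpace (𝓡 n) x)]
    [IsContMDiffRiemannianBundle (𝓡 n) ∞ (EuclideanSpace ℝ (Fin n))
      (fun x : M => TangentSpace (𝓡 n) x)]
    [IsRiemannianManifold (𝓡 n) M]
    (hM_or : IsOrientableManifold n M) (hM_euc : IsLocallyEuclidean n M)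
    {V E : Type*} [Finite V] [Nonempty V] [Finite E] [LinearOrder E]
    (G : SimilitudeGIFS V E M)
    (K : V → Set M) (hK : G.IsAttractor K)
    (F : ℕ → Finset (List E)) (Ω : V → Set M) (hG : G.IsGFTCFamily F Ω)
    {q : ℕ} (T : Fin q ≃ G.NbhdType F Ω (G.reducedVertices F))
    (A : ℝ → Matrix (Fin q) (Fin q) ℝ)
    (hA : ∀ β : ℝ, G.IsWeightedIncidenceMatrix F Ω T β (A β)) :
    ∃ α : ℝ, 0 ≤ α ∧ (∀ β : ℝ, (A β).realSpectralRadius = 1 ↔ β = α) ∧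
      dimH (⋃ i, K i) = ENNReal.ofReal α := by
  obtain ⟨hF, hΩ, hfin⟩ := hG
  have hV : Nonempty M := ⟨(hK.1 (Classical.arbitrary V)).some⟩
  have hnt : Nontrivial M := hM_euc.nontrivial hn
  have hconn : PreconnectedSpace M := preconnectedSpace_of_isRiemannianManifold n M
  have hsurj : ∀ e, Function.Surjective (G.map e) := fun e =>
    hM_euc.surjective_of_dist_eq (G.ratio_pos e) (G.dist_map e)
  obtain ⟨P, hP, hPl, hPr, rfl⟩ := SimilitudeGIFS.exists_forest hF hsurj T A hA
  -- The attractor is nonempty, so the reduced graph has a vertex and hence a type.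
  have hq : NeZero q := by
    obtain ⟨x, hx⟩ := hK.1 (Classical.arbitrary V)
    obtain ⟨s, -, hs, -⟩ := hK.exists_chain hF hx
    exact ⟨fun h => (h ▸ P.type ⟨s 0, SimilitudeGIFS.mem_reducedVertices_of_chain hs 0⟩ :
      Fin 0).elim0⟩
  obtain ⟨α, hα, hα1, hsub, hgt⟩ := P.exists_exponent
  refine ⟨α, hα, hα1, le_antisymm ?_ ?_⟩
  · refine ENNReal.le_of_forall_pos_le_add fun ε hε _ => ?_
    have hε' : (0 : ℝ) < ε := hε
    rw [dimH_iUnion, ← ENNReal.ofReal_coe_nnreal, ← ENNReal.ofReal_add hα ε.coe_nonneg]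
    exact iSup_le fun i => hK.dimH_le hF hP hPr (by linarith) (hgt _ (by linarith)) i
  -- The covering argument needs a positive exponent; for `α = 0` the lower bound is trivial.
  · rcases hα.eq_or_lt with rfl | hα0
    · simp
    · obtain ⟨i, hi⟩ := hK.exists_le_dimH hM_euc hsurj hΩ hP hPl hPr hα0 hsub
      exact hi.trans (dimH_mono (Set.subset_iUnion K i))
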